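/- Let $1<p<\infty$ and let $X$ be a proper metric space (closed bounded sets are compact) with a Borel measure $\mu$ (completed) such that $0<\mu(B)<\infty$ for all open balls $B$. A curve is a nonconstant rectifiable continuous map from a compact interval, parametrized by arc length. The $p$-modulus of a family $\Gamma$ of curves is the infimum of $\int_X\rho^p\,d\mu$ over Borel $\rho\colon X\to[0,\infty]$ with $\int_\gamma\rho\,ds\ge1$ for all $\gamma\in\Gamma$, and $p$-a.e. curve means all curves except for a family of $p$-modulus zero. Every open set $E\subset X$ is regarded as a metric measure space with the restricted metric and measure. A Borel function $g\colon E\to[0,\infty]$ is an upper gradient of $u\colon E\to[-\infty,\infty]$ if $|u(x)-u(y)|\le\int_\gamma g\,ds$ for all $x,y\in E$ and all curves $\gamma$ in $E$ joining $x$ and $y$, the left-hand side being $\infty$ if $u(x)$ or $u(y)$ is infinite; a measurable $g$ for which this holds for $p$-a.e. such curve is a $p$-weak upper gradient. $D^p(E)$ is the set of everywhere defined measurable $u\colon E\to[-\infty,\infty]$ having an upper gradient in $L^p(E)$. A function is in $D^p_{\mathrm{loc}}(E)$ (and similarly for $L^p_{\mathrm{loc}}$ and $N^{1,p}_{\mathrm{loc}}$)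 if every point of $E$ lies in some ball $B$ of the space $E$ such that the function is in $D^p(B)$. For $u\in D^p_{\mathrm{loc}}(E)$, $g_u$ denotes the minimal $p$-weak upper gradient: the a.e. smallest among the $p$-weak upper gradients of $u$ in $L^p_{\mathrm{loc}}(E)$. $N^{1,p}(E)$ is the set of $u\in D^p_{\mathrm{loc}}(E)$ with $\|u\|_{N^{1,p}(E)}^p:=\int_E|u|^p\,d\mu+\int_E g_u^p\,d\mu<\infty$. $D^p_0(E)$ (resp. $N^{1,p}_0(E)$) is the set of restrictions to $E$ of functions in $D^p(X)$ (resp. $N^{1,p}(X)$) that vanish on $X\setminus E$. The capacity of $A\subset X$ is $C_p(A)=\inf\|u\|^p_{N^{1,p}(X)}$ over $u\in N^{1,p}(X)$ with $u\ge1$ on $A$; q.e. means outside a set of capacity zero. Assume that $X$ supports a $(p,p)$-Poincaré inequality: there are $C>0$ and $\lambda\ge1$ such that for all balls $B=B(x,r)$, with $\lambda B=B(x,\lambda r)$, all integrable $u$ on $X$ and all upper gradients $g$ of $u$, $$\Bigl(\frac1{\mu(B)}\int_B|u-u_B|^p\,d\mu\Bigr)^{1/p}\le C\operatorname{diam}(B)\Bigl(\frac1{\mu(\lambda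 B)}\int_{\lambda B}g^p\,d\mu\Bigr)^{1/p},\qquad u_B=\frac1{\mu(B)}\int_Bu\,d\mu.$$ Let $\Omega\subset X$ be a nonempty (possibly unbounded) open set with $C_p(X\setminus\Omega)>0$, let $\psi\colon\Omega\to[-\infty,\infty]$ be any function, and let $f\in D^p(\Omega)$. Let $$\mathcal K_{\psi,f}=\{v\in D^p(\Omega): v-f\in D^p_0(\Omega)\text{ and }v\ge\psi\text{ q.e. in }\Omega\}.$$ Suppose that $u$ is a solution of the $\mathcal K_{\psi,f}$-obstacle problem, i.e. $u\in\mathcal K_{\psi,f}$ and $\int_\Omega g_u^p\,d\mu\le\int_\Omega g_v^p\,d\mu$ for all $v\in\mathcal K_{\psi,f}$. Then $u$ is a superminimizer in $\Omega$, i.e. $u\in N^{1,p}_{\mathrm{loc}}(\Omega)$ and $$\int_{\{\phi\ne0\}}g_u^p\,d\mu\le\int_{\{\phi\ne0\}}g_{u+\phi}^p\,d\mu\qquad\text{for all nonnegative }\phi\in N^{1,p}_0(\Omega).$$ -/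

import Mathlib

open MeasureTheory Metric Set
open scoped ENNReal NNReal

namespace ObstacleProblem

/-- A curve in `X`: a rectifiable nonconstant continuous map from a compact interval into `X`,
parametrized by arc length on `[0, length]`. (Unit speed on `[0, length]` means that the variation
over each `[s, t] ⊆ [0, length]` is `t - s`; in particular the map is `1`-Lipschitz there. The
values of `toFun` outside `[0, length]` are irrelevant.) -/
structure ArcCurve (X : Type*) [PseudoEMetricSpace X] where
  toFun : ℝ → X
  length : ℝ
  length_pos : 0 < length
  unitSpeed : HasUnitSpeedOn toFun (Icc 0 length)

section Curves

variable {X : Type*} [MetricSpace X]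

/-- The image of the curve is contained in `E`. -/
def ArcCurve.InSet (γ : ArcCurve X) (E : Set X) : Prop :=
  ∀ t ∈ Icc 0 γ.length, γ.toFun t ∈ E

/-- The curve integral `∫_γ g ds`. -/
noncomputable def ArcCurve.lineIntegral (γ : ArcCurve X) (g : X → ℝ≥0∞) : ℝ≥0∞ :=
  ∫⁻ t in Icc 0 γ.length, g (γ.toFun t)

/-- The upper gradient inequality `|u(x) - u(y)| ≤ ∫_γ g ds`, where `x` and `y` are the endpoints
of `γ`. In `EReal` both `⊤ - ⊤` and `⊥ - ⊥` equal `⊥`, so the left-hand side is `∞` as soon as one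
of `u(x)`, `u(y)` is infinite. -/
def UpperGradientIneq (u : X → EReal) (g : X → ℝ≥0∞) (γ : ArcCurve X) : Prop :=
  (u (γ.toFun 0) - u (γ.toFun γ.length)).abs ≤ γ.lineIntegral g

end Curves

section Spaces

variable {X : Type*} [MetricSpace X] [MeasurableSpace X]

/-! Below, a (Borel) subset `E` of `X` is regarded as a metric measure space in its own right, with
the restrictions of the metric and of the measure. Functions on `E` are represented by functions
on `X`; only their values on `E` matter. -/

/-- `g` is an upper gradient of `u` on the space `E`. -/
def IsUpperGradient (E : Set X) (u : X → EReal) (g : X → ℝ≥0∞) : Prop :=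
  Measurable g ∧ ∀ γ : ArcCurve X, γ.InSet E → UpperGradientIneq u g γ

/-- The `p`-modulus of a family of curves. -/
noncomputable def modulus (μ : Measure X) (p : ℝ) (Γ : Set (ArcCurve X)) : ℝ≥0∞ :=
  ⨅ (ρ : X → ℝ≥0∞) (_ : Measurable ρ) (_ : ∀ γ ∈ Γ, 1 ≤ γ.lineIntegral ρ), ∫⁻ x, ρ x ^ p ∂μ

/-- `g` is a `p`-weak upper gradient of `u` on the space `E`: it is measurable with respect to the
completed measure, and the upper gradient inequality holds for `p`-almost every curve in `E`.
(For curves in a Borel set `E` the modulus with respect to `E` and that with respect to `X`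
agree.) -/
def IsWeakUpperGradient (μ : Measure X) (p : ℝ) (E : Set X) (u : X → EReal) (g : X → ℝ≥0∞) :
    Prop :=
  AEMeasurable g (μ.restrict E) ∧
    modulus μ p {γ : ArcCurve X | γ.InSet E ∧ ¬ UpperGradientIneq u g γ} = 0

/-- The nonnegative function `g` is locally `p`-integrable on the space `E`. -/
def LocallyLp (μ : Measure X) (p : ℝ) (E : Set X) (g : X → ℝ≥0∞) : Prop :=
  ∀ x ∈ E, ∃ c ∈ E, ∃ r : ℝ, x ∈ ball c r ∧ ∫⁻ y in E ∩ ball c r, g y ^ p ∂μ < ∞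

/-- `g` is a minimal `p`-weak upper gradient of `u` on `E`: it is a locally `p`-integrable
`p`-weak upper gradient which is a.e. at most any other such one. -/
def IsMinimalWeakUpperGradient (μ : Measure X) (p : ℝ) (E : Set X) (u : X → EReal)
    (g : X → ℝ≥0∞) : Prop :=
  IsWeakUpperGradient μ p E u g ∧ LocallyLp μ p E g ∧
    ∀ g' : X → ℝ≥0∞, IsWeakUpperGradient μ p E u g' → LocallyLp μ p E g' →
      g ≤ᵐ[μ.restrict E] g'

open Classical in
/-- The minimal `p`-weak upper gradient `g_u` of `u` on `E`, unique up to a.e. equality on `E`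
(and `∞` if there is none, which does not happen for locally Dirichlet functions). -/
noncomputable def minGrad (μ : Measure X) (p : ℝ) (E : Set X) (u : X → EReal) : X → ℝ≥0∞ :=
  if h : ∃ g, IsMinimalWeakUpperGradient μ p E u g then h.choose else fun _ => ∞

/-- `u` belongs to the Dirichlet space `D^p(E)`. -/
def MemDirichlet (μ : Measure X) (p : ℝ) (E : Set X) (u : X → EReal) : Prop :=
  AEMeasurable u (μ.restrict E) ∧
    ∃ g : X → ℝ≥0∞, IsUpperGradient E u g ∧ ∫⁻ x in E, g x ^ p ∂μ < ∞

/-- `u` belongs to the local Dirichlet space `D^p_loc(E)`. -/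
def MemDirichletLoc (μ : Measure X) (p : ℝ) (E : Set X) (u : X → EReal) : Prop :=
  ∀ x ∈ E, ∃ c ∈ E, ∃ r : ℝ, x ∈ ball c r ∧ MemDirichlet μ p (E ∩ ball c r) u

/-- The `p`-th power `∫_E |u|^p dμ + ∫_E g_u^p dμ` of the Newtonian seminorm on `E`. -/
noncomputable def newtonianNormPow (μ : Measure X) (p : ℝ) (E : Set X) (u : X → EReal) : ℝ≥0∞ :=
  ∫⁻ x in E, (u x).abs ^ p ∂μ + ∫⁻ x in E, minGrad μ p E u x ^ p ∂μ

/-- `u` belongs to the Newtonian space `N^{1,p}(E)`. -/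
def MemNewtonian (μ : Measure X) (p : ℝ) (E : Set X) (u : X → EReal) : Prop :=
  MemDirichletLoc μ p E u ∧ newtonianNormPow μ p E u < ∞

/-- `u` belongs to the local Newtonian space `N^{1,p}_loc(E)`. -/
def MemNewtonianLoc (μ : Measure X) (p : ℝ) (E : Set X) (u : X → EReal) : Prop :=
  ∀ x ∈ E, ∃ c ∈ E, ∃ r : ℝ, x ∈ ball c r ∧ MemNewtonian μ p (E ∩ ball c r) u

/-- The Sobolev capacity `C_p(A)` of a subset `A` of `X`. -/
noncomputable def capacity (μ : Measure X) (p : ℝ) (A : Set X) : ℝ≥0∞ :=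
  ⨅ (u : X → EReal) (_ : MemNewtonian μ p univ u) (_ : ∀ x ∈ A, 1 ≤ u x),
    newtonianNormPow μ p univ u

/-- `u` (on `E`) belongs to `D^p_0(E)`: it is the restriction to `E` of a function in `D^p(X)`
that vanishes outside `E`. -/
def MemDirichletZero (μ : Measure X) (p : ℝ) (E : Set X) (u : X → EReal) : Prop :=
  ∃ w : X → EReal, MemDirichlet μ p univ w ∧ (∀ x ∉ E, w x = 0) ∧ ∀ x ∈ E, w x = u x

/-- `u` (on `E`) belongs to `N^{1,p}_0(E)`: it is the restriction to `E` of a function in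
`N^{1,p}(X)` that vanishes outside `E`. -/
def MemNewtonianZero (μ : Measure X) (p : ℝ) (E : Set X) (u : X → EReal) : Prop :=
  ∃ w : X → EReal, MemNewtonian μ p univ w ∧ (∀ x ∉ E, w x = 0) ∧ ∀ x ∈ E, w x = u x

/-- `X` supports a `(q, p)`-Poincaré inequality. -/
def SupportsPoincare (μ : Measure X) (q p : ℝ) : Prop :=
  ∃ C : ℝ≥0, 0 < C ∧ ∃ L : ℝ, 1 ≤ L ∧
    ∀ (c : X) (r : ℝ), 0 < r →
      ∀ u : X → ℝ, Integrable u μ →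
        ∀ g : X → ℝ≥0∞, IsUpperGradient univ (fun x => (u x : EReal)) g →
          (⨍⁻ x in ball c r, ‖u x - ⨍ y in ball c r, u y ∂μ‖ₑ ^ q ∂μ) ^ (1 / q) ≤
            C * ENNReal.ofReal (diam (ball c r)) *
              (⨍⁻ x in ball c (L * r), g x ^ p ∂μ) ^ (1 / p)

/-- `v` belongs to the class `K_{ψ,f}(V)` of admissible functions: `v ∈ D^p(V)`,
`v - f ∈ D^p_0(V)`, and `v ≥ ψ` outside a subset of `V` of zero capacity. (Points where `v - f` is
of the form `∞ - ∞` do not affect membership in `D^p_0(V)`, since almost no curve meets them.) -/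
def Admissible (μ : Measure X) (p : ℝ) (V : Set X) (ψ f v : X → EReal) : Prop :=
  MemDirichlet μ p V v ∧ MemDirichletZero μ p V (fun x => v x - f x) ∧
    capacity μ p {x ∈ V | ¬ ψ x ≤ v x} = 0

/-- `u` is a solution of the `K_{ψ,f}(V)`-obstacle problem. -/
def IsObstacleSolution (μ : Measure X) (p : ℝ) (V : Set X) (ψ f u : X → EReal) : Prop :=
  Admissible μ p V ψ f u ∧
    ∀ v : X → EReal, Admissible μ p V ψ f v →
      ∫⁻ x in V, minGrad μ p V u x ^ p ∂μ ≤ ∫⁻ x in V, minGrad μ p V v x ^ p ∂μ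

/-- `u` is a superminimizer in `V`. -/
def IsSuperminimizer (μ : Measure X) (p : ℝ) (V : Set X) (u : X → EReal) : Prop :=
  MemNewtonianLoc μ p V u ∧
    ∀ φ : X → EReal, MemNewtonianZero μ p V φ → (∀ x ∈ V, 0 ≤ φ x) →
      ∫⁻ x in {x ∈ V | φ x ≠ 0}, minGrad μ p V u x ^ p ∂μ ≤
        ∫⁻ x in {x ∈ V | φ x ≠ 0}, minGrad μ p V (fun y => u y + φ y) x ^ p ∂μ

end Spaces

end ObstacleProblem

/-! For nonnegative `φ ∈ N^{1,p}_0(Ω)` the function `u + φ` is again admissible, so `∫_Ω g_u^p ≤ ∫_Ω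
g_{u+φ}^p`. Minimal weak upper gradients are local: `g_{u+φ} ≤ g_u` a.e. on `{φ = 0}`. The finite
contribution of that set therefore cancels, which leaves the inequality on `{φ ≠ 0}`.

Existence and locality of `g_u` rest on `eventually_controlled`: along `p`-a.e. curve, `u ∘ γ` is
finite and absolutely continuous with derivative bounded by `g ∘ γ`. Infima, minima and pastings of
weak upper gradients then become a.e. statements about derivatives on an interval. A minimizing
sequence yields `g_u` (`MemDirichlet.exists_minimal`), and since absolutely continuous functions
have equal derivatives a.e. where they agree, pasting gives locality (`minGrad_ae_le_of_eq`).

That `u ∈ N^{1,p}_loc(Ω)` needs the Poincaré inequality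
(`MemDirichlet.exists_ball_lintegral_lt_top`): applied to the truncations of `u` it gives `L^p`
bounds independent of the truncation level, once `|u| = ∞` a.e. on a ball is excluded. This
exclusion fails on a one-point space; positive capacity of the complement provides a second point.
-/

namespace ObstacleProblem

open Filter Topology

/-! ### Absolutely continuous functions on an interval -/

section OneDimensional

/-- A function whose increments are dominated by those of an absolutely continuous function is
absolutely continuous. -/
theorem absolutelyContinuousOnInterval_of_dist_le {a H : ℝ → ℝ} {l r : ℝ}
    (hH : AbsolutelyContinuousOnInterval H l r)
    (h : ∀ s ∈ uIcc l r, ∀ t ∈ uIcc l r, dist (a s) (a t) ≤ dist (H s) (H t)) :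
    AbsolutelyContinuousOnInterval a l r := by
  rw [absolutelyContinuousOnInterval_iff] at hH ⊢
  intro ε hε
  obtain ⟨δ, hδ, H'⟩ := hH ε hε
  refine ⟨δ, hδ, fun E hE hlen => lt_of_le_of_lt (Finset.sum_le_sum fun i hi => ?_) (H' E hE hlen)⟩
  exact h _ (hE.1 i hi).1 _ (hE.1 i hi).2

variable {a : ℝ → ℝ} {h : ℝ → ℝ≥0∞} {l : ℝ}

theorem dist_le_dist_primitive (hm : AEMeasurable h (volume.restrict (Icc 0 l)))
    (hfin : ∫⁻ t in Icc 0 l, h t < ∞)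
    (hinc : ∀ s t, 0 ≤ s → s < t → t ≤ l →
      ENNReal.ofReal |a s - a t| ≤ ∫⁻ x in Icc s t, h x) {s t : ℝ}
    (hs : s ∈ Icc 0 l) (ht : t ∈ Icc 0 l) :
    dist (a s) (a t) ≤
      dist (∫ x in (0 : ℝ)..s, (h x).toReal) (∫ x in (0 : ℝ)..t, (h x).toReal) := by
  wlog hst : s < t generalizing s t
  · rcases (not_lt.1 hst).eq_or_lt with e | hlt
    · simp [e]
    · rw [dist_comm (a s), dist_comm (intervalIntegral _ _ _ _)]
      exact this ht hs hlt
  have hI : IntegrableOn (fun x => (h x).toReal) (Icc 0 l) :=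
    integrable_toReal_of_lintegral_ne_top hm hfin.ne
  have hsub : Icc s t ⊆ Icc 0 l := Icc_subset_Icc hs.1 ht.2
  have hii : ∀ r ∈ Icc 0 l, IntervalIntegrable (fun x => (h x).toReal) volume 0 r := fun r hr => by
    rw [intervalIntegrable_iff_integrableOn_Icc_of_le hr.1]
    exact hI.mono_set (Icc_subset_Icc le_rfl hr.2)
  rw [dist_comm (intervalIntegral _ _ _ _), Real.dist_eq, Real.dist_eq,
    intervalIntegral.integral_interval_sub_left (hii t ht) (hii s hs),
    intervalIntegral.integral_of_le hst.le, ← integral_Icc_eq_integral_Ioc]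
  have hmono : ∫⁻ x in Icc s t, h x ≤ ∫⁻ x in Icc 0 l, h x := lintegral_mono_set hsub
  have hne := (hmono.trans_lt hfin).ne
  rw [integral_toReal (hm.mono_measure (Measure.restrict_mono hsub le_rfl))
    (ae_lt_top' (hm.mono_measure (Measure.restrict_mono hsub le_rfl)) hne)]
  rw [abs_of_nonneg ENNReal.toReal_nonneg]
  exact (ENNReal.ofReal_le_iff_le_toReal hne).1 (hinc s t hs.1 hst ht.2)

/-- The increments of `a` are dominated by those of the primitive of `h`. This gives absolute
continuity, and comparing difference quotients at a point where both functions are differentiable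
bounds the derivative. -/
theorem absolutelyContinuous_of_increment_le (hl : 0 < l)
    (hm : AEMeasurable h (volume.restrict (Icc 0 l)))
    (hfin : ∫⁻ t in Icc 0 l, h t < ∞)
    (hinc : ∀ s t, 0 ≤ s → s < t → t ≤ l →
      ENNReal.ofReal |a s - a t| ≤ ∫⁻ x in Icc s t, h x) :
    AbsolutelyContinuousOnInterval a 0 l ∧
      ∀ᵐ t ∂volume.restrict (Icc 0 l), ‖deriv a t‖ₑ ≤ h t := by
  have hI : IntegrableOn (fun x => (h x).toReal) (Icc 0 l) :=
    integrable_toReal_of_lintegral_ne_top hm hfin.ne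
  have hii : IntervalIntegrable (fun x => (h x).toReal) volume 0 l := by
    rwa [intervalIntegrable_iff_integrableOn_Icc_of_le hl.le]
  have hd := fun s hs t ht => dist_le_dist_primitive (s := s) (t := t) hm hfin hinc hs ht
  have hac : AbsolutelyContinuousOnInterval a 0 l :=
    absolutelyContinuousOnInterval_of_dist_le
      (hii.absolutelyContinuousOnInterval_intervalIntegral (c := 0) (by simp))
      (by rwa [uIcc_of_le hl.le])
  refine ⟨hac, ?_⟩
  have hne : ∀ᵐ t ∂volume.restrict (Icc 0 l), t ≠ 0 ∧ t ≠ l := by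
    refine ae_restrict_of_ae ?_
    filter_upwards [Measure.ae_ne volume (0 : ℝ), Measure.ae_ne volume l] with t h0 h1
      using ⟨h0, h1⟩
  filter_upwards [ae_restrict_of_ae hac.ae_differentiableAt,
    ae_restrict_of_ae hii.ae_hasDerivAt_integral, ae_restrict_mem measurableSet_Icc,
    ae_lt_top' hm hfin.ne, hne] with t hda hdH ht htop htne
  rw [uIcc_of_le hl.le] at hda hdH
  have h1 := (hasDerivAt_iff_tendsto_slope.1 (hda ht).hasDerivAt).norm
  have h2 := (hasDerivAt_iff_tendsto_slope.1 (hdH ht 0 ⟨le_rfl, hl.le⟩)).norm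
  have hle : ‖deriv a t‖ ≤ ‖(h t).toReal‖ := by
    refine le_of_tendsto_of_tendsto h1 h2 ?_
    have hnhds : Icc 0 l ∈ 𝓝[≠] t := mem_nhdsWithin_of_mem_nhds
      (Icc_mem_nhds (lt_of_le_of_ne ht.1 (Ne.symm htne.1)) (lt_of_le_of_ne ht.2 htne.2))
    filter_upwards [hnhds] with y hy
    simp only [slope, vsub_eq_sub, norm_smul]
    gcongr
    simpa [dist_eq_norm] using hd y hy t ht
  rw [← ofReal_norm, Real.norm_of_nonneg ENNReal.toReal_nonneg] at *
  exact ENNReal.ofReal_le_of_le_toReal hle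

theorem increment_le_of_deriv_le {k : ℝ → ℝ≥0∞} (hl : 0 < l)
    (hac : AbsolutelyContinuousOnInterval a 0 l)
    (hk : ∀ᵐ t ∂volume.restrict (Icc 0 l), ‖deriv a t‖ₑ ≤ k t) :
    ENNReal.ofReal |a 0 - a l| ≤ ∫⁻ t in Icc 0 l, k t := by
  rw [abs_sub_comm, ← Real.norm_eq_abs, ofReal_norm, ← hac.integral_deriv_eq_sub,
    intervalIntegral.integral_of_le hl.le, ← integral_Icc_eq_integral_Ioc]
  exact (enorm_integral_le_lintegral_enorm _).trans (lintegral_mono_ae hk)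

/-- The non-accumulation points of a subset of the line form a countable set. -/
theorem countable_setOf_not_accPt (T : Set ℝ) : {t ∈ T | ¬ AccPt t (𝓟 T)}.Countable := by
  have hD : DiscreteTopology {t ∈ T | ¬ AccPt t (𝓟 T)} := by
    rw [discreteTopology_subtype_iff]
    rintro t ⟨-, ht⟩
    have h2 : 𝓝[≠] t ⊓ 𝓟 T = ⊥ := by simpa [AccPt] using ht
    exact le_bot_iff.1 (h2 ▸ inf_le_inf_left _ (principal_mono.2 fun x hx => hx.1))
  exact countable_coe_iff.1 (TopologicalSpace.separableSpace_iff_countable.1 inferInstance)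

/-- Almost every point of the coincidence set is one of its accumulation points, and there the
derivative within the set is unique. This is the source of the locality of minimal gradients. -/
theorem ae_deriv_eq_of_eq {b : ℝ → ℝ} (hl : 0 < l)
    (ha : AbsolutelyContinuousOnInterval a 0 l) (hb : AbsolutelyContinuousOnInterval b 0 l) :
    ∀ᵐ t ∂volume.restrict (Icc 0 l), a t = b t → deriv a t = deriv b t := by
  set T : Set ℝ := {t | a t = b t}
  filter_upwards [ae_restrict_of_ae ha.ae_differentiableAt,
    ae_restrict_of_ae hb.ae_differentiableAt, ae_restrict_mem measurableSet_Icc,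
    ae_restrict_of_ae ((countable_setOf_not_accPt T).ae_notMem volume)] with t hat hbt ht hT he
  rw [uIcc_of_le hl.le] at hat hbt
  have hacc : AccPt t (𝓟 T) := by
    by_contra hc
    exact hT ⟨he, hc⟩
  have h1 := (hat ht).hasDerivAt.hasDerivWithinAt (s := T)
  have h2 := ((hbt ht).hasDerivAt.hasDerivWithinAt (s := T)).congr (f₁ := a) (fun x hx => hx) he
  exact (uniqueDiffWithinAt_iff_accPt.2 hacc).eq_deriv _ h1 h2

end OneDimensional

/-! ### Arc-length curves and subcurves -/

section Curves

variable {X : Type*} [MetricSpace X]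

theorem ArcCurve.edist_le (γ : ArcCurve X) {s t : ℝ} (hs : s ∈ Icc 0 γ.length)
    (ht : t ∈ Icc 0 γ.length) (hst : s ≤ t) :
    edist (γ.toFun s) (γ.toFun t) ≤ ENNReal.ofReal (t - s) := by
  have h := γ.unitSpeed hs ht
  simp only [NNReal.coe_one, one_mul] at h
  rw [← h]
  exact eVariationOn.edist_le _ ⟨hs, le_rfl, hst⟩ ⟨ht, hst, le_rfl⟩

theorem ArcCurve.continuousOn (γ : ArcCurve X) : ContinuousOn γ.toFun (Icc 0 γ.length) := by
  have : LipschitzOnWith 1 γ.toFun (Icc 0 γ.length) := by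
    intro s hs t ht
    rw [ENNReal.coe_one, one_mul]
    rcases le_total s t with h | h
    · rw [edist_comm s t, edist_dist t s, Real.dist_eq, abs_of_nonneg (by linarith)]
      exact γ.edist_le hs ht h
    · rw [edist_comm, edist_dist s t, Real.dist_eq, abs_of_nonneg (by linarith)]
      exact γ.edist_le ht hs h
  exact this.continuousOn

/-- The subcurve of `γ` between the parameters `s` and `t`. -/
def ArcCurve.sub (γ : ArcCurve X) (s t : ℝ) (hs : 0 ≤ s) (hst : s < t) (ht : t ≤ γ.length) :
    ArcCurve X where
  toFun := fun x => γ.toFun (x + s)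
  length := t - s
  length_pos := sub_pos.2 hst
  unitSpeed := by
    intro x hx y hy
    have hmono : MonotoneOn (fun z : ℝ => z + s) (Icc 0 (t - s)) :=
      fun a _ b _ hab => by simpa using hab
    have h1 := eVariationOn.comp_inter_Icc_eq_of_monotoneOn γ.toFun _ hmono hx hy
    have h2 : (fun z : ℝ => z + s) '' Icc 0 (t - s) ∩ Icc (x + s) (y + s) =
        Icc 0 γ.length ∩ Icc (x + s) (y + s) := by
      rw [image_add_const_Icc]
      ext z
      simp only [mem_inter_iff, mem_Icc] at hx hy ⊢
      constructor <;> rintro ⟨⟨_, _⟩, _, _⟩ <;> refine ⟨⟨?_, ?_⟩, ?_, ?_⟩ <;> linarith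
    have h3 := γ.unitSpeed (x := x + s) ⟨by linarith [hx.1], by linarith [hx.2]⟩
      (y := y + s) ⟨by linarith [hy.1], by linarith [hy.2]⟩
    rw [h2, h3] at h1
    rw [add_sub_add_right_eq_sub] at h1
    exact h1

theorem ArcCurve.lineIntegral_sub (γ : ArcCurve X) {s t : ℝ} (hs : 0 ≤ s) (hst : s < t)
    (ht : t ≤ γ.length) (g : X → ℝ≥0∞) :
    (γ.sub s t hs hst ht).lineIntegral g = ∫⁻ x in Icc s t, g (γ.toFun x) := by
  have h := (measurePreserving_add_right (volume : Measure ℝ) s).setLIntegral_comp_preimage_emb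
    (MeasurableEquiv.addRight s).measurableEmbedding (fun x => g (γ.toFun x)) (Icc s t)
  rw [← h]
  simp [ArcCurve.lineIntegral, ArcCurve.sub]

theorem ArcCurve.InSet.sub {γ : ArcCurve X} {E : Set X} (h : γ.InSet E) {s t : ℝ} (hs : 0 ≤ s)
    (hst : s < t) (ht : t ≤ γ.length) : (γ.sub s t hs hst ht).InSet E := by
  intro x hx
  refine h (x + s) ⟨by linarith [hx.1], ?_⟩
  have : x ≤ t - s := hx.2
  linarith

theorem ArcCurve.lineIntegral_mono (γ : ArcCurve X) {g g' : X → ℝ≥0∞} (h : ∀ x, g x ≤ g' x) :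
    γ.lineIntegral g ≤ γ.lineIntegral g' :=
  lintegral_mono fun _ => h _

theorem ArcCurve.InSet.mono {γ : ArcCurve X} {E F : Set X} (h : γ.InSet E) (hEF : E ⊆ F) :
    γ.InSet F := fun t ht => hEF (h t ht)

theorem ArcCurve.InSet.lineIntegral_congr {γ : ArcCurve X} {E : Set X} (h : γ.InSet E)
    {g g' : X → ℝ≥0∞} (hgg : ∀ x ∈ E, g x = g' x) : γ.lineIntegral g = γ.lineIntegral g' :=
  setLIntegral_congr_fun measurableSet_Icc fun t ht => hgg _ (h t ht)

end Curves

/-! ### Modulus and properties of almost every curve -/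

section Modulus

variable {X : Type*} [MetricSpace X] [MeasurableSpace X]

theorem modulus_mono (μ : Measure X) (p : ℝ) {Γ Γ' : Set (ArcCurve X)} (h : Γ ⊆ Γ') :
    modulus μ p Γ ≤ modulus μ p Γ' :=
  le_iInf₂ fun ρ hρ => le_iInf fun hΓ =>
    iInf₂_le_of_le ρ hρ (iInf_le_of_le (fun γ hγ => hΓ γ (h hγ)) le_rfl)

theorem modulus_eq_zero_iff {μ : Measure X} {p : ℝ} {Γ : Set (ArcCurve X)} :
    modulus μ p Γ = 0 ↔ ∀ ε : ℝ≥0∞, 0 < ε → ∃ ρ : X → ℝ≥0∞, Measurable ρ ∧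
      (∀ γ ∈ Γ, 1 ≤ γ.lineIntegral ρ) ∧ ∫⁻ x, ρ x ^ p ∂μ < ε := by
  rw [modulus, ← nonpos_iff_eq_zero, ← bot_eq_zero', le_bot_iff, iInf_eq_bot]
  constructor
  · intro h ε hε
    obtain ⟨ρ, hρ⟩ := h ε hε
    simp only [iInf_lt_iff] at hρ
    obtain ⟨hm, ha, hl⟩ := hρ
    exact ⟨ρ, hm, ha, hl⟩
  · intro h ε hε
    obtain ⟨ρ, hm, ha, hl⟩ := h ε hε
    refine ⟨ρ, ?_⟩
    simp only [iInf_lt_iff]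
    exact ⟨hm, ha, hl⟩

theorem iSup_rpow_le_tsum {p : ℝ} (hp : 0 < p) (a : ℕ → ℝ≥0∞) :
    (⨆ n, a n) ^ p ≤ ∑' n, a n ^ p := by
  have h : (⨆ n, a n) ^ p = ⨆ n, a n ^ p := (ENNReal.orderIsoRpow p hp).map_iSup a
  rw [h]
  exact iSup_le fun n => ENNReal.le_tsum n

/-- Combining test densities by a supremum instead of a sum makes the energies subadditive for every
`p > 0`, without Minkowski's inequality. -/
theorem lintegral_iSup_rpow_le {α : Type*} [MeasurableSpace α] {μ : Measure α} {p : ℝ}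
    (hp : 0 < p) {ρ : ℕ → α → ℝ≥0∞}
    (hρ : ∀ n, Measurable (ρ n)) :
    ∫⁻ x, (⨆ n, ρ n x) ^ p ∂μ ≤ ∑' n, ∫⁻ x, ρ n x ^ p ∂μ := by
  rw [← lintegral_tsum fun n => ((hρ n).pow_const p).aemeasurable]
  exact lintegral_mono fun x => iSup_rpow_le_tsum hp _

/-- A curve family of zero modulus is charged infinitely by a `p`-integrable Borel function. -/
theorem exists_lineIntegral_eq_top {μ : Measure X} {p : ℝ} (hp : 0 < p) {Γ : Set (ArcCurve X)}
    (h : modulus μ p Γ = 0) :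
    ∃ ρ : X → ℝ≥0∞, Measurable ρ ∧ (∀ γ ∈ Γ, γ.lineIntegral ρ = ∞) ∧ ∫⁻ x, ρ x ^ p ∂μ < ∞ := by
  obtain ⟨δ, hδ, hδs⟩ := ENNReal.exists_pos_sum_of_countable' (one_ne_zero) ℕ
  have hc : ∀ n : ℕ, ((n : ℝ≥0∞) + 1) ^ p ≠ 0 := fun n => by
    simp [ENNReal.rpow_eq_zero_iff, hp, hp.not_gt]
  have hc' : ∀ n : ℕ, ((n : ℝ≥0∞) + 1) ^ p ≠ ∞ := fun n =>
    ENNReal.rpow_ne_top_of_nonneg hp.le (by finiteness)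
  -- With this accuracy `(n + 1) ρ n` has energy below the summable `δ n`, while its integral along
  -- each curve of `Γ` is at least `n + 1`.
  choose ρ hm ha hl using fun n : ℕ => modulus_eq_zero_iff.1 h (δ n / ((n : ℝ≥0∞) + 1) ^ p)
    (ENNReal.div_pos (hδ n).ne' (hc' n))
  have hm' : ∀ n : ℕ, Measurable fun x => ((n : ℝ≥0∞) + 1) * ρ n x := fun n =>
    (hm n).const_mul _
  refine ⟨fun x => ⨆ n : ℕ, ((n : ℝ≥0∞) + 1) * ρ n x, .iSup hm', ?_, ?_⟩
  · intro γ hγ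
    refine ENNReal.eq_top_of_forall_nnreal_le fun r => ?_
    obtain ⟨n, hn⟩ := exists_nat_ge r
    calc (r : ℝ≥0∞) ≤ ((n : ℝ≥0∞) + 1) * 1 := by
          rw [mul_one]
          exact le_add_right (by exact_mod_cast hn)
      _ ≤ ((n : ℝ≥0∞) + 1) * γ.lineIntegral (ρ n) := by gcongr; exact ha n γ hγ
      _ = γ.lineIntegral (fun x => ((n : ℝ≥0∞) + 1) * ρ n x) :=
          (lintegral_const_mul' _ _ (by finiteness)).symm
      _ ≤ _ := γ.lineIntegral_mono fun x => le_iSup (fun n : ℕ => ((n : ℝ≥0∞) + 1) * ρ n x) n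
  · refine (lintegral_iSup_rpow_le hp hm').trans_lt
      (lt_of_le_of_lt ?_ (hδs.trans ENNReal.one_lt_top))
    refine ENNReal.tsum_le_tsum fun n => ?_
    simp_rw [ENNReal.mul_rpow_of_nonneg _ _ hp.le]
    rw [lintegral_const_mul _ ((hm n).pow_const p), mul_comm]
    exact ((ENNReal.lt_div_iff_mul_lt (Or.inl (hc n)) (Or.inl (hc' n))).1 (hl n)).le

theorem modulus_eq_zero_of_lineIntegral_eq_top {μ : Measure X} {p : ℝ} (hp : 0 < p)
    {Γ : Set (ArcCurve X)} {ρ : X → ℝ≥0∞} (hρ : Measurable ρ)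
    (hΓ : ∀ γ ∈ Γ, γ.lineIntegral ρ = ∞) (hfin : ∫⁻ x, ρ x ^ p ∂μ < ∞) : modulus μ p Γ = 0 := by
  rw [modulus_eq_zero_iff]
  intro ε hε
  have hlim : Tendsto (fun n : ℕ => ((n : ℝ≥0∞)⁻¹) ^ p * ∫⁻ x, ρ x ^ p ∂μ) atTop (𝓝 0) := by
    have h1 : Tendsto (fun n : ℕ => ((n : ℝ≥0∞)⁻¹) ^ p) atTop (𝓝 (0 ^ p)) :=
      (ENNReal.continuous_rpow_const.tendsto 0).comp ENNReal.tendsto_inv_nat_nhds_zero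
    rw [ENNReal.zero_rpow_of_pos hp] at h1
    simpa using ENNReal.Tendsto.mul_const h1 (Or.inr hfin.ne)
  obtain ⟨n, hn, hn0⟩ := ((hlim.eventually_lt_const hε).and (eventually_gt_atTop 0)).exists
  refine ⟨fun x => (n : ℝ≥0∞)⁻¹ * ρ x, hρ.const_mul _, fun γ hγ => ?_, ?_⟩
  · have hne : (n : ℝ≥0∞)⁻¹ ≠ ∞ := by simp [hn0.ne']
    rw [ArcCurve.lineIntegral, lintegral_const_mul' _ _ hne]
    have := hΓ γ hγ
    rw [ArcCurve.lineIntegral] at this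
    rw [this, ENNReal.mul_top (by simp)]
    exact le_top
  · simp_rw [ENNReal.mul_rpow_of_nonneg _ _ hp.le]
    rwa [lintegral_const_mul _ (hρ.pow_const p)]

theorem modulus_iUnion_eq_zero {μ : Measure X} {p : ℝ} (hp : 0 < p)
    {S : ℕ → Set (ArcCurve X)} (h : ∀ n, modulus μ p (S n) = 0) :
    modulus μ p (⋃ n, S n) = 0 := by
  choose ρ hm ha hl using fun n => modulus_eq_zero_iff.1 (h n)
  rw [modulus_eq_zero_iff]
  intro ε hε
  obtain ⟨δ, hδ, hδs⟩ := ENNReal.exists_pos_sum_of_countable' hε.ne' ℕ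
  refine ⟨fun x => ⨆ n, ρ n (δ n) (hδ n) x, .iSup fun n => hm n _ _, fun γ hγ => ?_, ?_⟩
  · obtain ⟨n, hn⟩ := mem_iUnion.1 hγ
    exact (ha n _ (hδ n) γ hn).trans
      (γ.lineIntegral_mono fun x => le_iSup (fun n => ρ n (δ n) (hδ n) x) n)
  · refine (lintegral_iSup_rpow_le hp fun n => hm n _ _).trans_lt (lt_of_le_of_lt ?_ hδs)
    exact ENNReal.tsum_le_tsum fun n => (hl n _ _).le

/-- The filter of properties that hold for `p`-almost every curve in `E`. -/
def aeCurve (μ : Measure X) {p : ℝ} (hp : 0 < p) (E : Set X) : Filter (ArcCurve X) :=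
  Filter.ofCountableInter {S | modulus μ p {γ | γ.InSet E ∧ γ ∉ S} = 0}
    (fun S hS hmem => by
      rcases S.eq_empty_or_nonempty with rfl | hne
      · simp only [sInter_empty, mem_univ, not_true_eq_false, and_false, mem_ofPred_eq]
        exact modulus_eq_zero_iff.2 fun ε hε =>
          ⟨0, measurable_zero, by simp, by simpa [ENNReal.zero_rpow_of_pos hp] using hε⟩
      obtain ⟨T, rfl⟩ := hS.exists_eq_range hne
      have h := modulus_iUnion_eq_zero hp fun n : ℕ => hmem (mem_range_self n)
      refine nonpos_iff_eq_zero.1 (h ▸ modulus_mono μ p ?_)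
      rintro γ ⟨hE, hγ⟩
      simp only [sInter_range, mem_iInter, not_forall] at hγ
      obtain ⟨n, hn⟩ := hγ
      exact mem_iUnion.2 ⟨n, hE, hn⟩)
    (fun S T hS hST => nonpos_iff_eq_zero.1
      (hS ▸ modulus_mono μ p fun γ hγ => ⟨hγ.1, fun h => hγ.2 (hST h)⟩))

instance (μ : Measure X) {p : ℝ} (hp : 0 < p) (E : Set X) :
    CountableInterFilter (aeCurve μ hp E) := by
  unfold aeCurve; infer_instance

variable {μ : Measure X} {p : ℝ} {E : Set X}

theorem eventually_aeCurve (hp : 0 < p) {P : ArcCurve X → Prop} :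
    (∀ᶠ γ in aeCurve μ hp E, P γ) ↔ modulus μ p {γ | γ.InSet E ∧ ¬ P γ} = 0 :=
  Iff.rfl

theorem eventually_aeCurve_of_forall (hp : 0 < p) {P : ArcCurve X → Prop}
    (h : ∀ γ : ArcCurve X, γ.InSet E → P γ) : ∀ᶠ γ in aeCurve μ hp E, P γ := by
  have : ∀ᶠ γ in aeCurve μ hp E, True := Filter.univ_mem
  rw [eventually_aeCurve] at this ⊢
  refine nonpos_iff_eq_zero.1 (this ▸ modulus_mono μ p ?_)
  rintro γ ⟨hE, hγ⟩
  exact absurd (h γ hE) hγ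

theorem eventually_inSet (hp : 0 < p) : ∀ᶠ γ in aeCurve μ hp E, γ.InSet E :=
  eventually_aeCurve_of_forall hp fun _ h => h

/-- A density that is admissible for the bad curves is admissible for every curve with a bad
subcurve, because the integral over the whole curve is larger. -/
theorem eventually_sub (hp : 0 < p) {P : ArcCurve X → Prop}
    (h : ∀ᶠ γ in aeCurve μ hp E, P γ) :
    ∀ᶠ γ in aeCurve μ hp E, ∀ (s t : ℝ) (hs : 0 ≤ s) (hst : s < t) (ht : t ≤ γ.length),
      P (γ.sub s t hs hst ht) := by
  rw [eventually_aeCurve, modulus_eq_zero_iff] at h ⊢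
  intro ε hε
  obtain ⟨ρ, hm, ha, hl⟩ := h ε hε
  refine ⟨ρ, hm, ?_, hl⟩
  rintro γ ⟨hE, hγ⟩
  push Not at hγ
  obtain ⟨s, t, hs, hst, ht, hP⟩ := hγ
  refine (ha _ ⟨hE.sub hs hst ht, hP⟩).trans ?_
  rw [γ.lineIntegral_sub]
  exact lintegral_mono_set (Icc_subset_Icc hs ht)

theorem eventually_lineIntegral_lt_top (hp : 0 < p) {g : X → ℝ≥0∞} (hg : Measurable g)
    (hfin : ∫⁻ x, g x ^ p ∂μ < ∞) :
    ∀ᶠ γ in aeCurve μ hp E, γ.lineIntegral g < ∞ := by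
  rw [eventually_aeCurve]
  refine modulus_eq_zero_of_lineIntegral_eq_top hp hg ?_ hfin
  rintro γ ⟨-, hγ⟩
  simpa using hγ

variable [BorelSpace X]

theorem ArcCurve.aemeasurable (γ : ArcCurve X) :
    AEMeasurable γ.toFun (volume.restrict (Icc 0 γ.length)) :=
  γ.continuousOn.aemeasurable measurableSet_Icc

theorem ArcCurve.aemeasurable_comp (γ : ArcCurve X) {g : X → ℝ≥0∞} (hg : Measurable g) :
    AEMeasurable (fun t => g (γ.toFun t)) (volume.restrict (Icc 0 γ.length)) :=
  hg.comp_aemeasurable γ.aemeasurable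

/-- Along `p`-almost every curve, almost everywhere equal functions agree at almost every
parameter. -/
theorem eventually_ae_of_ae (hp : 0 < p) (hE : MeasurableSet E) {P : X → Prop}
    (h : ∀ᵐ x ∂μ.restrict E, P x) :
    ∀ᶠ γ in aeCurve μ hp E, ∀ᵐ t ∂volume.restrict (Icc 0 γ.length), P (γ.toFun t) := by
  rw [ae_restrict_iff' hE] at h
  obtain ⟨N, hN, hNm, hN0⟩ := exists_measurable_superset_of_null (ae_iff.1 h)
  rw [eventually_aeCurve]
  -- The density `∞ · 1_N` has zero energy, yet its integral is infinite along any curve that spends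
  -- positive length in the null set `N`.
  refine modulus_eq_zero_of_lineIntegral_eq_top hp
    (ρ := N.indicator fun _ => ∞) (measurable_const.indicator hNm) ?_ ?_
  · rintro γ ⟨hγ, hbad⟩
    by_contra hne
    apply hbad
    filter_upwards [ae_lt_top' (γ.aemeasurable_comp (measurable_const.indicator hNm)) hne,
      ae_restrict_mem measurableSet_Icc] with t ht htI
    by_contra hP
    have : γ.toFun t ∈ N := hN (by simp [hγ t htI, hP])
    simp [this] at ht
  · have : ∀ x, (N.indicator (fun _ => (∞ : ℝ≥0∞)) x) ^ p =
      N.indicator (fun _ => ∞) x := fun x => by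
      by_cases hx : x ∈ N <;> simp [hx, ENNReal.zero_rpow_of_pos hp, ENNReal.top_rpow_of_pos hp]
    simp_rw [this]
    rw [lintegral_indicator hNm]
    simp [hN0]

/-- A locally `p`-integrable Borel function has finite integral along `p`-almost every curve. -/
theorem eventually_lineIntegral_lt_top_of_locallyLp [SecondCountableTopology X] (hp : 0 < p)
    (hE : IsOpen E) {g : X → ℝ≥0∞} (hg : Measurable g) (hloc : LocallyLp μ p E g) :
    ∀ᶠ γ in aeCurve μ hp E, γ.lineIntegral g < ∞ := by
  choose! c hc r hr hfin using hloc
  -- Countably many of the balls suffice to cover `E`, so almost every curve has finite integral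
  -- over all of them; being compact, it needs only finitely many.
  obtain ⟨T, hT, hTE⟩ := TopologicalSpace.isOpen_iUnion_countable
    (fun x : E => E ∩ ball (c x) (r x)) fun x => hE.inter isOpen_ball
  have hcover : E ⊆ ⋃ x ∈ T, E ∩ ball (c x) (r x) := by
    rw [hTE]
    exact fun x hx => mem_iUnion.2 ⟨⟨x, hx⟩, hx, hr x hx⟩
  have hU : ∀ x : E, MeasurableSet (E ∩ ball (c x) (r x)) := fun x =>
    (hE.inter isOpen_ball).measurableSet
  have hall : ∀ᶠ γ in aeCurve μ hp E, ∀ x ∈ T,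
      γ.lineIntegral ((E ∩ ball (c x) (r x)).indicator g) < ∞ := by
    rw [eventually_countable_ball hT]
    intro x _
    refine eventually_lineIntegral_lt_top hp (hg.indicator (hU x)) ?_
    have : ∀ y, ((E ∩ ball (c x) (r x)).indicator g y) ^ p =
        (E ∩ ball (c x) (r x)).indicator (fun y => g y ^ p) y := fun y => by
      by_cases hy : y ∈ E ∩ ball (c x) (r x)
      · rw [indicator_of_mem hy, indicator_of_mem hy]
      · rw [indicator_of_notMem hy, indicator_of_notMem hy, ENNReal.zero_rpow_of_pos hp]
    simp_rw [this]
    rw [lintegral_indicator (hU x)]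
    exact hfin x x.2
  filter_upwards [hall, eventually_inSet hp] with γ hγ hin
  have hK : IsCompact (γ.toFun '' Icc 0 γ.length) :=
    isCompact_Icc.image_of_continuousOn γ.continuousOn
  obtain ⟨b, hbT, hbfin, hb⟩ := hK.elim_finite_subcover_image (b := T)
    (c := fun x : E => E ∩ ball (c x) (r x)) (fun x _ => hE.inter isOpen_ball)
    ((image_subset_iff.2 fun t ht => hin t ht).trans hcover)
  lift b to Finset E using hbfin
  calc γ.lineIntegral g ≤ ∫⁻ t in Icc 0 γ.length,
        ∑ x ∈ b, (E ∩ ball (c x) (r x)).indicator g (γ.toFun t) := by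
        refine setLIntegral_mono' measurableSet_Icc fun t ht => ?_
        obtain ⟨x, hx, hxt⟩ := mem_iUnion₂.1 (hb (mem_image_of_mem _ ht))
        rw [← indicator_of_mem hxt g]
        exact Finset.single_le_sum (f := fun x : E => (E ∩ ball (c x) (r x)).indicator g (γ.toFun t))
          (fun _ _ => zero_le) hx
    _ = ∑ x ∈ b, γ.lineIntegral ((E ∩ ball (c x) (r x)).indicator g) :=
        lintegral_finsetSum' _ fun x _ => γ.aemeasurable_comp (hg.indicator (hU x))
    _ < ∞ := ENNReal.sum_lt_top.2 fun x hx => hγ x (hbT hx)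

end Modulus

/-! ### Differences of extended reals -/

section EReal

theorem ereal_finite_of_abs_sub_lt_top {x y : EReal} (h : (x - y).abs < ∞) :
    (x ≠ ⊤ ∧ x ≠ ⊥) ∧ y ≠ ⊤ ∧ y ≠ ⊥ := by
  induction x <;> induction y <;> simp_all

theorem ereal_abs_sub_eq {x y : EReal} (hx : x ≠ ⊤ ∧ x ≠ ⊥) (hy : y ≠ ⊤ ∧ y ≠ ⊥) :
    (x - y).abs = ENNReal.ofReal |x.toReal - y.toReal| := by
  lift x to ℝ using hx
  lift y to ℝ using hy
  rw [← EReal.coe_sub, EReal.abs_def, EReal.toReal_coe, EReal.toReal_coe]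

/-- Either the right-hand side is infinite, or the convention `|∞ - ∞| = ∞` forces all four numbers
to be real. -/
theorem ereal_abs_add_sub_add_le (a b c d : EReal) :
    ((a + c) - (b + d)).abs ≤ (a - b).abs + (c - d).abs := by
  by_cases h1 : (a - b).abs = ∞
  · simp [h1]
  by_cases h2 : (c - d).abs = ∞
  · simp [h2]
  obtain ⟨ha, hb⟩ := ereal_finite_of_abs_sub_lt_top (lt_top_iff_ne_top.2 h1)
  obtain ⟨hc, hd⟩ := ereal_finite_of_abs_sub_lt_top (lt_top_iff_ne_top.2 h2)
  lift a to ℝ using ha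
  lift b to ℝ using hb
  lift c to ℝ using hc
  lift d to ℝ using hd
  norm_cast
  simp only [EReal.abs_def]
  rw [← ENNReal.ofReal_add (abs_nonneg _) (abs_nonneg _)]
  refine ENNReal.ofReal_le_ofReal ?_
  rw [add_sub_add_comm]
  exact abs_add_le _ _

end EReal

/-! ### Weak upper gradients, their minimality and locality -/

section WeakUpperGradients

variable {X : Type*} [MetricSpace X]

/-- `u` is finite and absolutely continuous along `γ`, with derivative bounded by `g`. -/
structure Controlled (u : X → EReal) (g : X → ℝ≥0∞) (γ : ArcCurve X) : Prop where
  finite : ∀ t ∈ Icc 0 γ.length, u (γ.toFun t) ≠ ⊤ ∧ u (γ.toFun t) ≠ ⊥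
  ac : AbsolutelyContinuousOnInterval (fun t => (u (γ.toFun t)).toReal) 0 γ.length
  deriv_le : ∀ᵐ t ∂volume.restrict (Icc 0 γ.length),
    ‖deriv (fun t => (u (γ.toFun t)).toReal) t‖ₑ ≤ g (γ.toFun t)

theorem Controlled.upperGradientIneq {u : X → EReal} {g : X → ℝ≥0∞} {γ : ArcCurve X}
    (h : Controlled u g γ) : UpperGradientIneq u g γ := by
  have h0 : (0 : ℝ) ∈ Icc 0 γ.length := ⟨le_rfl, γ.length_pos.le⟩
  have h1 : γ.length ∈ Icc 0 γ.length := ⟨γ.length_pos.le, le_rfl⟩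
  rw [UpperGradientIneq, ereal_abs_sub_eq (h.finite _ h0) (h.finite _ h1)]
  exact increment_le_of_deriv_le γ.length_pos h.ac h.deriv_le

theorem UpperGradientIneq.add {u v : X → EReal} {g h : X → ℝ≥0∞} {γ : ArcCurve X}
    [MeasurableSpace X] [BorelSpace X] (hg : Measurable g)
    (hu : UpperGradientIneq u g γ) (hv : UpperGradientIneq v h γ) :
    UpperGradientIneq (fun x => u x + v x) (fun x => g x + h x) γ := by
  refine (ereal_abs_add_sub_add_le _ _ _ _).trans ((add_le_add hu hv).trans_eq ?_)
  exact (lintegral_add_left' (γ.aemeasurable_comp hg) _).symm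

variable [MeasurableSpace X] {μ : Measure X} {p : ℝ} {E : Set X} {u : X → EReal}
  {g : X → ℝ≥0∞}

theorem isWeakUpperGradient_iff (hp : 0 < p) :
    IsWeakUpperGradient μ p E u g ↔
      AEMeasurable g (μ.restrict E) ∧ ∀ᶠ γ in aeCurve μ hp E, UpperGradientIneq u g γ :=
  Iff.rfl

theorem IsUpperGradient.isWeakUpperGradient (hp : 0 < p) (h : IsUpperGradient E u g) :
    IsWeakUpperGradient μ p E u g :=
  (isWeakUpperGradient_iff hp).2
    ⟨h.1.aemeasurable, eventually_aeCurve_of_forall hp h.2⟩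

theorem locallyLp_of_lintegral_lt_top (h : ∫⁻ x in E, g x ^ p ∂μ < ∞) : LocallyLp μ p E g :=
  fun x hx => ⟨x, hx, 1, mem_ball_self one_pos, (lintegral_mono_set inter_subset_left).trans_lt h⟩

theorem LocallyLp.congr {g' : X → ℝ≥0∞} (h : LocallyLp μ p E g) (hgg : g =ᵐ[μ.restrict E] g') :
    LocallyLp μ p E g' := by
  intro x hx
  obtain ⟨c, hc, r, hr, hfin⟩ := h x hx
  refine ⟨c, hc, r, hr, lt_of_eq_of_lt (lintegral_congr_ae ?_) hfin⟩
  filter_upwards [ae_restrict_of_ae_restrict_of_subset inter_subset_left hgg] with y hy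
  rw [hy]

theorem MemDirichlet.mono {F : Set X} (hu : MemDirichlet μ p E u) (hF : F ⊆ E) :
    MemDirichlet μ p F u := by
  obtain ⟨hm, g, hg, hfin⟩ := hu
  exact ⟨hm.mono_measure (Measure.restrict_mono hF le_rfl), g,
    ⟨hg.1, fun γ hγ => hg.2 γ (hγ.mono hF)⟩, (lintegral_mono_set hF).trans_lt hfin⟩

theorem MemDirichlet.congr {v : X → EReal} (hE : MeasurableSet E) (hu : MemDirichlet μ p E u)
    (huv : ∀ x ∈ E, u x = v x) : MemDirichlet μ p E v := by
  obtain ⟨hm, g, hg, hfin⟩ := hu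
  refine ⟨hm.congr (ae_restrict_of_forall_mem hE huv), g, ⟨hg.1, fun γ hγ => ?_⟩, hfin⟩
  have := hg.2 γ hγ
  rwa [UpperGradientIneq, huv _ (hγ 0 ⟨le_rfl, γ.length_pos.le⟩),
    huv _ (hγ _ ⟨γ.length_pos.le, le_rfl⟩)] at this

theorem memDirichlet_zero (hp : 0 < p) : MemDirichlet μ p E (fun _ => 0) :=
  ⟨aemeasurable_const, fun _ => 0, ⟨measurable_const, fun γ _ => by simp [UpperGradientIneq]⟩,
    by simp [ENNReal.zero_rpow_of_pos hp]⟩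

theorem capacity_mono {A B : Set X} (h : A ⊆ B) : capacity μ p A ≤ capacity μ p B :=
  le_iInf₂ fun u hu => le_iInf fun hB =>
    iInf₂_le_of_le u hu (iInf_le_of_le (fun x hx => hB x (h hx)) le_rfl)

variable [BorelSpace X]

theorem MemDirichlet.add (hp : 1 ≤ p) {v : X → EReal} (hu : MemDirichlet μ p E u)
    (hv : MemDirichlet μ p E v) : MemDirichlet μ p E (fun x => u x + v x) := by
  obtain ⟨hum, g, hg, hgfin⟩ := hu
  obtain ⟨hvm, h, hh, hhfin⟩ := hv
  refine ⟨hum.add hvm, fun x => g x + h x, ⟨hg.1.add hh.1, fun γ hγ =>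
    UpperGradientIneq.add hg.1 (hg.2 γ hγ) (hh.2 γ hγ)⟩, ?_⟩
  exact ENNReal.lintegral_rpow_add_lt_top_of_lintegral_rpow_lt_top hg.1.aemeasurable
    hgfin hhfin hp

/-- Almost every curve satisfies the upper gradient inequality on all its subcurves and has finite
integral of `g`, so the increments of `u ∘ γ` are bounded by an integrable density. The converse is
`Controlled.upperGradientIneq`. -/
theorem eventually_controlled [SecondCountableTopology X] (hp : 0 < p) (hE : IsOpen E)
    (h : IsWeakUpperGradient μ p E u g) (hloc : LocallyLp μ p E g) :
    ∀ᶠ γ in aeCurve μ hp E, Controlled u g γ := by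
  have hm := h.1
  filter_upwards [eventually_lineIntegral_lt_top_of_locallyLp hp hE hm.measurable_mk
    (hloc.congr hm.ae_eq_mk), eventually_sub hp ((isWeakUpperGradient_iff hp).1 h).2,
    eventually_ae_of_ae hp hE.measurableSet hm.ae_eq_mk] with γ hfin hsub hae
  have hineq : ∀ s t, 0 ≤ s → s < t → t ≤ γ.length →
      (u (γ.toFun s) - u (γ.toFun t)).abs ≤ ∫⁻ x in Icc s t, hm.mk g (γ.toFun x) := by
    intro s t hs hst ht
    have h1 := hsub s t hs hst ht
    rw [UpperGradientIneq, γ.lineIntegral_sub] at h1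
    simp only [ArcCurve.sub, zero_add, sub_add_cancel] at h1
    refine h1.trans_eq (lintegral_congr_ae ?_)
    exact ae_restrict_of_ae_restrict_of_subset (Icc_subset_Icc hs ht) hae
  have hlt : ∀ s t, 0 ≤ s → s < t → t ≤ γ.length →
      (u (γ.toFun s) - u (γ.toFun t)).abs < ∞ := fun s t hs hst ht =>
    ((hineq s t hs hst ht).trans (lintegral_mono_set (Icc_subset_Icc hs ht))).trans_lt hfin
  have hfinite : ∀ t ∈ Icc 0 γ.length, u (γ.toFun t) ≠ ⊤ ∧ u (γ.toFun t) ≠ ⊥ := by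
    intro t ht
    -- Each parameter is an endpoint of a nondegenerate subcurve ending at `γ.length`, except the
    -- last one, for which the whole curve is used.
    rcases ht.2.eq_or_lt with rfl | hlt'
    · exact (ereal_finite_of_abs_sub_lt_top (hlt 0 _ le_rfl γ.length_pos le_rfl)).2
    · exact (ereal_finite_of_abs_sub_lt_top (hlt t _ ht.1 hlt' le_rfl)).1
  obtain ⟨hac, hd⟩ := absolutelyContinuous_of_increment_le
    (a := fun t => (u (γ.toFun t)).toReal) γ.length_pos
    (γ.aemeasurable_comp hm.measurable_mk) hfin fun s t hs hst ht => by
      have h2 := hineq s t hs hst ht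
      rwa [ereal_abs_sub_eq (hfinite s ⟨hs, hst.le.trans ht⟩)
        (hfinite t ⟨hs.trans hst.le, ht⟩)] at h2
  refine ⟨hfinite, hac, ?_⟩
  filter_upwards [hd, hae] with t h1 h2
  exact h1.trans_eq h2.symm

/-- A `p`-integrable `p`-weak upper gradient is dominated by a `p`-integrable upper gradient. -/
theorem IsWeakUpperGradient.exists_isUpperGradient (hp : 0 < p) (hE : MeasurableSet E)
    (h : IsWeakUpperGradient μ p E u g) (hfin : ∫⁻ x in E, g x ^ p ∂μ < ∞) :
    ∃ g' : X → ℝ≥0∞, IsUpperGradient E u g' ∧ ∫⁻ x in E, g' x ^ p ∂μ < ∞ := by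
  have hm := h.1
  have hbad : ∀ᶠ γ in aeCurve μ hp E, UpperGradientIneq u (hm.mk g) γ := by
    filter_upwards [((isWeakUpperGradient_iff hp).1 h).2,
      eventually_ae_of_ae hp hE hm.ae_eq_mk] with γ h1 h2
    exact h1.trans_eq (lintegral_congr_ae h2)
  -- Since `ρ` has infinite integral along the exceptional curves, taking the maximum with it makes
  -- the inequality true on every curve.
  obtain ⟨ρ, hρ, hΓ, hρfin⟩ := exists_lineIntegral_eq_top hp ((eventually_aeCurve hp).1 hbad)
  refine ⟨fun x => max (hm.mk g x) (ρ x), ⟨hm.measurable_mk.max hρ, fun γ hγ => ?_⟩, ?_⟩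
  · by_cases hu : UpperGradientIneq u (hm.mk g) γ
    · exact hu.trans (γ.lineIntegral_mono fun x => le_max_left _ _)
    · have := hΓ γ ⟨hγ, hu⟩
      exact le_top.trans (this.symm.le.trans (γ.lineIntegral_mono fun x => le_max_right _ _))
  · calc ∫⁻ x in E, max (hm.mk g x) (ρ x) ^ p ∂μ
        ≤ ∫⁻ x in E, hm.mk g x ^ p + ρ x ^ p ∂μ := by
          refine lintegral_mono fun x => ?_
          rcases max_cases (hm.mk g x) (ρ x) with ⟨h, -⟩ | ⟨h, -⟩ <;> simp [h]
      _ = ∫⁻ x in E, g x ^ p ∂μ + ∫⁻ x in E, ρ x ^ p ∂μ := by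
          rw [lintegral_add_left (hm.measurable_mk.pow_const p)]
          congr 1
          exact lintegral_congr_ae (hm.ae_eq_mk.symm.fun_comp (· ^ p))
      _ < ∞ := ENNReal.add_lt_top.2 ⟨hfin, (setLIntegral_le_lintegral _ _).trans_lt hρfin⟩

variable [SecondCountableTopology X]

theorem IsWeakUpperGradient.min {g' : X → ℝ≥0∞} (hp : 0 < p) (hE : IsOpen E)
    (h : IsWeakUpperGradient μ p E u g) (hloc : LocallyLp μ p E g)
    (h' : IsWeakUpperGradient μ p E u g') (hloc' : LocallyLp μ p E g') :
    IsWeakUpperGradient μ p E u (fun x => min (g x) (g' x)) := by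
  refine (isWeakUpperGradient_iff hp).2 ⟨h.1.min h'.1, ?_⟩
  filter_upwards [eventually_controlled hp hE h hloc, eventually_controlled hp hE h' hloc']
    with γ h1 h2
  refine Controlled.upperGradientIneq ⟨h1.finite, h1.ac, ?_⟩
  filter_upwards [h1.deriv_le, h2.deriv_le] with t ht1 ht2 using le_min ht1 ht2

/-- Along almost every curve the derivative is bounded by every `G n` at almost every parameter,
hence by the infimum; countability keeps both exceptional sets negligible. -/
theorem IsWeakUpperGradient.iInf {G : ℕ → X → ℝ≥0∞} (hp : 0 < p) (hE : IsOpen E)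
    (h : ∀ n, IsWeakUpperGradient μ p E u (G n)) (hloc : ∀ n, LocallyLp μ p E (G n)) :
    IsWeakUpperGradient μ p E u (fun x => ⨅ n, G n x) := by
  refine (isWeakUpperGradient_iff hp).2 ⟨.iInf fun n => (h n).1, ?_⟩
  filter_upwards [eventually_countable_forall.2 fun n => eventually_controlled hp hE (h n) (hloc n)]
    with γ hγ
  refine Controlled.upperGradientIneq ⟨(hγ 0).finite, (hγ 0).ac, ?_⟩
  filter_upwards [ae_all_iff.2 fun n => (hγ n).deriv_le] with t ht using le_iInf ht

/-- A `p`-weak upper gradient of `u` may be replaced by one of `v` on the set `{u = v}`. -/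
theorem IsWeakUpperGradient.piecewise {v : X → EReal} {g' : X → ℝ≥0∞} (hp : 0 < p)
    (hE : IsOpen E) (h : IsWeakUpperGradient μ p E u g) (hloc : LocallyLp μ p E g)
    (h' : IsWeakUpperGradient μ p E v g') (hloc' : LocallyLp μ p E g') {S : Set X}
    (hS : MeasurableSet S) (huv : ∀ᵐ x ∂μ.restrict E, x ∈ S → u x = v x) [DecidablePred (· ∈ S)] :
    IsWeakUpperGradient μ p E u (S.piecewise g' g) := by
  have hm : AEMeasurable (S.piecewise g' g) (μ.restrict E) := by
    refine ⟨S.piecewise (h'.1.mk g') (h.1.mk g),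
      h'.1.measurable_mk.piecewise hS h.1.measurable_mk, ?_⟩
    filter_upwards [h'.1.ae_eq_mk, h.1.ae_eq_mk] with x h1 h2
    by_cases hx : x ∈ S <;> simp [hx, h1, h2]
  refine (isWeakUpperGradient_iff hp).2 ⟨hm, ?_⟩
  filter_upwards [eventually_controlled hp hE h hloc, eventually_controlled hp hE h' hloc',
    eventually_ae_of_ae hp hE.measurableSet huv] with γ h1 h2 h3
  refine Controlled.upperGradientIneq ⟨h1.finite, h1.ac, ?_⟩
  filter_upwards [h1.deriv_le, h2.deriv_le, ae_deriv_eq_of_eq γ.length_pos h1.ac h2.ac, h3]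
    with t ht1 ht2 heq ht
  by_cases hS : γ.toFun t ∈ S
  · rw [piecewise_eq_of_mem _ _ _ hS, heq (by rw [ht hS])]
    exact ht2
  · rwa [piecewise_eq_of_notMem _ _ _ hS]

/-- Every Dirichlet function has a minimal `p`-weak upper gradient. -/
theorem MemDirichlet.exists_minimal (hp : 0 < p) (hE : IsOpen E) (hu : MemDirichlet μ p E u) :
    ∃ g, IsMinimalWeakUpperGradient μ p E u g ∧ ∫⁻ x in E, g x ^ p ∂μ < ∞ := by
  obtain ⟨-, g₀, hg₀, hfin₀⟩ := hu
  -- The set of energies of `p`-integrable weak upper gradients. The pointwise infimum of a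
  -- minimizing sequence attains `sInf A`.
  let A : Set ℝ≥0∞ :=
    {m | ∃ g, IsWeakUpperGradient μ p E u g ∧ ∫⁻ x in E, g x ^ p ∂μ < ∞ ∧
      ∫⁻ x in E, g x ^ p ∂μ = m}
  have hA : A.Nonempty := ⟨_, g₀, hg₀.isWeakUpperGradient hp, hfin₀, rfl⟩
  obtain ⟨m, -, hm, hmA⟩ := exists_seq_tendsto_sInf hA (OrderBot.bddBelow A)
  choose G hG hGfin hGm using hmA
  have hGle : ∀ n, ∫⁻ x in E, (⨅ n, G n x) ^ p ∂μ ≤ m n := fun n => by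
    rw [← hGm n]
    exact lintegral_mono fun x => ENNReal.rpow_le_rpow (iInf_le _ n) hp.le
  have hle : ∫⁻ x in E, (⨅ n, G n x) ^ p ∂μ ≤ sInf A := ge_of_tendsto' hm hGle
  have hfin : ∫⁻ x in E, (⨅ n, G n x) ^ p ∂μ < ∞ :=
    (hGle 0).trans_lt (hGm 0 ▸ hGfin 0)
  have hweak := IsWeakUpperGradient.iInf hp hE hG fun n => locallyLp_of_lintegral_lt_top (hGfin n)
  have hloc : LocallyLp μ p E (fun x => ⨅ n, G n x) := locallyLp_of_lintegral_lt_top hfin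
  refine ⟨_, ⟨hweak, hloc, fun g' hg' hloc' => ?_⟩, hfin⟩
  -- The minimum with a competitor `g'` has no smaller energy, so it equals the minimizer a.e. It is
  -- `p`-integrable even if `g'` is only locally so.
  have hmin := hweak.min hp hE hloc hg' hloc'
  have hminle : ∀ x, (min (⨅ n, G n x) (g' x)) ^ p ≤ (⨅ n, G n x) ^ p := fun x =>
    ENNReal.rpow_le_rpow (min_le_left _ _) hp.le
  have hminfin := (lintegral_mono (μ := μ.restrict E) hminle).trans_lt hfin
  have hge : ∫⁻ x in E, (⨅ n, G n x) ^ p ∂μ ≤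
      ∫⁻ x in E, (min (⨅ n, G n x) (g' x)) ^ p ∂μ :=
    hle.trans (sInf_le ⟨_, hmin, hminfin, rfl⟩)
  have hae := ae_eq_of_ae_le_of_lintegral_le (ae_of_all _ hminle) hminfin.ne
    (hweak.1.pow_const p) hge
  filter_upwards [hae] with x hx
  have : min (⨅ n, G n x) (g' x) = ⨅ n, G n x :=
    (ENNReal.strictMono_rpow_of_pos hp).injective hx
  exact min_eq_left_iff.1 this

theorem MemDirichlet.minGrad_spec (hp : 0 < p) (hE : IsOpen E) (hu : MemDirichlet μ p E u) :
    IsMinimalWeakUpperGradient μ p E u (minGrad μ p E u) ∧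
      ∫⁻ x in E, minGrad μ p E u x ^ p ∂μ < ∞ := by
  obtain ⟨g, hg, hfin⟩ := hu.exists_minimal hp hE
  have hex : ∃ g, IsMinimalWeakUpperGradient μ p E u g := ⟨g, hg⟩
  have hspec : IsMinimalWeakUpperGradient μ p E u (minGrad μ p E u) := by
    rw [minGrad, dif_pos hex]
    exact hex.choose_spec
  refine ⟨hspec, lt_of_le_of_lt (lintegral_mono_ae ?_) hfin⟩
  filter_upwards [hspec.2.2 g hg.1 hg.2.1] with x hx using ENNReal.rpow_le_rpow hx hp.le

/-- Minimal `p`-weak upper gradients are local: they are ordered on the set where the functions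
agree. -/
theorem minGrad_ae_le_of_eq {v : X → EReal} (hp : 0 < p) (hE : IsOpen E)
    (hu : MemDirichlet μ p E u) (hv : MemDirichlet μ p E v) {S : Set X} (hS : MeasurableSet S)
    (huv : ∀ᵐ x ∂μ.restrict E, x ∈ S → u x = v x) :
    ∀ᵐ x ∂μ.restrict E, x ∈ S → minGrad μ p E u x ≤ minGrad μ p E v x := by
  classical
  obtain ⟨⟨hu1, hu2, hu3⟩, hufin⟩ := hu.minGrad_spec hp hE
  obtain ⟨⟨hv1, hv2, -⟩, hvfin⟩ := hv.minGrad_spec hp hE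
  -- Using the gradient of `v` on `S` gives a competitor for `u`, to which minimality applies.
  have hpw := hu1.piecewise hp hE hu2 hv1 hv2 hS huv
  have hfin : ∫⁻ x in E, S.piecewise (minGrad μ p E v) (minGrad μ p E u) x ^ p ∂μ < ∞ := by
    calc _ ≤ ∫⁻ x in E, minGrad μ p E v x ^ p + minGrad μ p E u x ^ p ∂μ := by
          refine lintegral_mono fun x => ?_
          by_cases hx : x ∈ S <;> simp [hx]
      _ = _ := lintegral_add_left' (hv1.1.pow_const p) _
      _ < ∞ := ENNReal.add_lt_top.2 ⟨hvfin, hufin⟩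
  filter_upwards [hu3 _ hpw (locallyLp_of_lintegral_lt_top hfin)] with x hx hxS
  rwa [piecewise_eq_of_mem _ _ _ hxS] at hx

/-- A function in `N^{1,p}(X)` belongs to `D^p(X)`. -/
theorem MemNewtonian.memDirichlet (hp : 0 < p) (hμ : μ univ ≠ 0)
    (hu : MemNewtonian μ p univ u) : MemDirichlet μ p univ u := by
  obtain ⟨hloc, hnorm⟩ := hu
  have hmeas : AEMeasurable u (μ.restrict univ) := by
    choose c hc r hr hD using fun x : X => hloc x (mem_univ x)
    obtain ⟨T, hT, hTE⟩ := TopologicalSpace.isOpen_iUnion_countable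
      (fun x : X => univ ∩ ball (c x) (r x)) fun x => isOpen_univ.inter isOpen_ball
    have hcov : (⋃ x : T, univ ∩ ball (c x) (r x)) = univ := by
      rw [iUnion_coe_set, hTE]
      exact eq_univ_of_forall fun x => mem_iUnion.2 ⟨x, mem_univ x, hr x⟩
    have := hT.to_subtype
    rw [← hcov, aemeasurable_iUnion_iff]
    exact fun x => (hD x).1
  have hfin : ∫⁻ x in univ, minGrad μ p univ u x ^ p ∂μ < ∞ :=
    (le_add_left le_rfl).trans_lt hnorm
  have hex : ∃ g, IsMinimalWeakUpperGradient μ p univ u g := by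
    -- Without a minimal gradient, `minGrad` takes its default value `∞`, whose energy is infinite
    -- because `μ univ ≠ 0`.
    by_contra hne
    rw [minGrad, dif_neg hne] at hfin
    simp [ENNReal.top_rpow_of_pos hp, ENNReal.top_mul hμ] at hfin
  have hspec : IsMinimalWeakUpperGradient μ p univ u (minGrad μ p univ u) := by
    rw [minGrad, dif_pos hex]
    exact hex.choose_spec
  exact ⟨hmeas, hspec.1.exists_isUpperGradient hp MeasurableSet.univ hfin⟩

/-- The zero function is a competitor of norm zero. This turns positive capacity into nonemptiness.
-/
theorem capacity_empty (hp : 0 < p) : capacity μ p ∅ = 0 := by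
  have hD : MemDirichlet μ p (univ : Set X) (fun _ => 0) := memDirichlet_zero hp
  have h0 : IsUpperGradient (univ : Set X) (fun _ => 0) (fun _ => 0) :=
    ⟨measurable_const, fun γ _ => by simp [UpperGradientIneq]⟩
  have hle := (hD.minGrad_spec hp isOpen_univ).1.2.2 _ (h0.isWeakUpperGradient hp)
    (locallyLp_of_lintegral_lt_top (by simp [ENNReal.zero_rpow_of_pos hp]))
  have hnorm : newtonianNormPow μ p (univ : Set X) (fun _ => 0) = 0 := by
    have h1 : ∫⁻ x in univ, minGrad μ p univ (fun _ : X => 0) x ^ p ∂μ = ∫⁻ _ in univ, 0 ∂μ := by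
      refine lintegral_congr_ae ?_
      filter_upwards [hle] with x hx
      rw [nonpos_iff_eq_zero.1 hx, ENNReal.zero_rpow_of_pos hp]
    rw [newtonianNormPow, h1]
    simp [ENNReal.zero_rpow_of_pos hp]
  refine nonpos_iff_eq_zero.1 (hnorm ▸ iInf₂_le_of_le (fun _ => 0)
    ⟨fun x _ => ⟨x, mem_univ x, 1, mem_ball_self one_pos, hD.mono (subset_univ _)⟩,
      hnorm ▸ ENNReal.zero_lt_top⟩ (iInf_le_of_le (by simp) le_rfl))

end WeakUpperGradients

/-! ### Truncation of extended real functions -/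

section Truncation

/-- The truncation of an extended real number at the levels `-k` and `k`. -/
noncomputable def trunc (k : ℕ) (a : EReal) : ℝ :=
  (max (-(k : ℝ) : ℝ) (min a (k : ℝ)) : EReal).toReal

theorem trunc_coe (k : ℕ) (a : ℝ) : trunc k a = max (-(k : ℝ)) (min a k) := by
  rw [trunc]
  norm_cast

theorem trunc_top (k : ℕ) : trunc k ⊤ = k := by
  have : max (-(k : ℝ)) (k : ℝ) = k :=
    max_eq_right (by linarith [(Nat.cast_nonneg k : (0 : ℝ) ≤ k)])
  rw [trunc, min_eq_right le_top, ← EReal.coe_strictMono.monotone.map_max, this,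
    EReal.toReal_coe]

theorem trunc_bot (k : ℕ) : trunc k ⊥ = -k := by
  rw [trunc, min_eq_left bot_le, max_eq_left bot_le, EReal.toReal_coe]

theorem enorm_trunc (k : ℕ) (a : EReal) : ‖trunc k a‖ₑ = min a.abs k := by
  induction a with
  | bot => simp [trunc_bot]
  | top => simp [trunc_top]
  | coe a =>
    rw [trunc_coe, Real.enorm_eq_ofReal_abs, EReal.abs_def, ← ENNReal.ofReal_natCast k,
      ← ENNReal.ofReal_min]
    congr 1
    have hk : (0 : ℝ) ≤ k := Nat.cast_nonneg k
    rcases le_total 0 a with ha | ha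
    · rw [max_eq_right (le_min (by linarith) (by linarith)), abs_of_nonneg (le_min ha hk),
        abs_of_nonneg ha]
    · rw [min_eq_left (by linarith), abs_of_nonpos (max_le (by linarith) ha), abs_of_nonpos ha,
        ← min_neg_neg, neg_neg, min_comm]

/-- Truncation is 1-Lipschitz, so an upper gradient of `u` serves for all its truncations; these are
real-valued, as the Poincaré inequality requires. -/
theorem abs_trunc_sub_trunc_le (k : ℕ) (a b : EReal) :
    ENNReal.ofReal |trunc k a - trunc k b| ≤ (a - b).abs := by
  by_cases h : (a - b).abs = ∞
  · simp [h]
  obtain ⟨ha, hb⟩ := ereal_finite_of_abs_sub_lt_top (lt_top_iff_ne_top.2 h)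
  rw [ereal_abs_sub_eq ha hb]
  lift a to ℝ using ha
  lift b to ℝ using hb
  rw [trunc_coe, trunc_coe]
  refine ENNReal.ofReal_le_ofReal ?_
  simp only [EReal.toReal_coe]
  refine (abs_max_sub_max_le_max _ _ _ _).trans (max_le (by simp) ?_)
  exact (abs_min_sub_min_le_max _ _ _ _).trans (max_le le_rfl (by simp))

theorem measurable_trunc (k : ℕ) : Measurable (trunc k) :=
  EReal.measurable_of_measurable_real (by
    simp_rw [trunc_coe]
    fun_prop)

theorem measurable_ereal_abs : Measurable EReal.abs :=
  EReal.measurable_of_measurable_real (by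
    simp_rw [EReal.abs_def]
    fun_prop)

end Truncation

/-! ### Consequences of the Poincaré inequality -/

section Poincare

variable {X : Type*} [MetricSpace X] [MeasurableSpace X] [BorelSpace X] {μ : Measure X} {p : ℝ}

theorem exists_mem_of_ae_restrict {α : Type*} [MeasurableSpace α] {μ : Measure α}
    {A B : Set α} {P : α → Prop} (hA : MeasurableSet A)
    (hAB : A ⊆ B) (hA0 : μ A ≠ 0) (h : ∀ᵐ y ∂μ.restrict B, P y) : ∃ y ∈ A, P y := by
  have : (ae (μ.restrict A)).NeBot := ae_restrict_neBot.2 hA0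
  obtain ⟨y, h1, h2⟩ := ((ae_restrict_mem hA).and
    (ae_restrict_of_ae_restrict_of_subset hAB h)).exists
  exact ⟨y, h1, h2⟩

/-- Finiteness puts almost every parameter in the closed ball, and continuity then puts all of them
there. Hence an upper gradient on the ball becomes a global one when extended by `∞`. -/
theorem ArcCurve.inSet_closedBall_of_lineIntegral_ne_top {γ : ArcCurve X} {x : X} {R : ℝ}
    {g : X → ℝ≥0∞} (hg : Measurable g) (hx : ∀ y ∉ closedBall x R, g y = ∞)
    (hfin : γ.lineIntegral g ≠ ∞) : γ.InSet (closedBall x R) := by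
  have hcont : ContinuousOn (fun t => max (dist (γ.toFun t) x) R) (Icc 0 γ.length) :=
    ((continuous_id.dist continuous_const).max continuous_const).comp_continuousOn γ.continuousOn
  have hae : (fun t => max (dist (γ.toFun t) x) R) =ᵐ[volume.restrict (Icc 0 γ.length)]
      fun _ => R := by
    filter_upwards [ae_lt_top' (γ.aemeasurable_comp hg) hfin] with t ht
    by_contra hne
    refine ht.ne (hx _ fun hmem => hne (max_eq_right hmem))
  intro t ht
  exact max_eq_right_iff.1
    (Measure.eqOn_Icc_of_ae_eq volume γ.length_pos.ne hae hcont continuousOn_const ht)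

/-- On small balls, the Poincaré inequality only needs the upper gradient inequality along curves
in a concentric closed ball. -/
theorem SupportsPoincare.exists_ball (hp : 0 < p)
    (hμ : ∀ (x : X) (r : ℝ), 0 < r → 0 < μ (ball x r) ∧ μ (ball x r) < ∞)
    (hPI : SupportsPoincare μ p p) (x : X) {R : ℝ} (hR : 0 < R) :
    ∃ r, 0 < r ∧ r ≤ R ∧ ∃ K : ℝ≥0∞, K < ∞ ∧ ∀ (w : X → ℝ) (g : X → ℝ≥0∞), Integrable w μ →
      Measurable g →
      (∀ γ : ArcCurve X, γ.InSet (closedBall x R) →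
        ENNReal.ofReal |w (γ.toFun 0) - w (γ.toFun γ.length)| ≤ γ.lineIntegral g) →
      ∫⁻ y in ball x r, ‖w y - ⨍ z in ball x r, w z ∂μ‖ₑ ^ p ∂μ ≤
        K * ∫⁻ y in closedBall x R, g y ^ p ∂μ := by
  classical
  obtain ⟨C, -, L, hL, hPI⟩ := hPI
  have hL0 : 0 < L := one_pos.trans_le hL
  have hr : 0 < R / L := div_pos hR hL0
  have hLr : L * (R / L) = R := by field_simp
  obtain ⟨hB0, hB⟩ := hμ x _ hr
  obtain ⟨hR0, -⟩ := hμ x _ hR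
  have hD : (C : ℝ≥0∞) * ENNReal.ofReal (diam (ball x (R / L))) ≠ ∞ := by finiteness
  -- With radius `R / L` the enlarged ball of the Poincaré inequality is `ball x R`, where the
  -- extension by `∞` still equals `g`. The constant comes from taking `p`-th powers and clearing
  -- the averages.
  refine ⟨R / L, hr, div_le_self hR.le hL,
    μ (ball x (R / L)) * ((C * ENNReal.ofReal (diam (ball x (R / L)))) ^ p * (μ (ball x R))⁻¹),
    ?_, fun w g hw hg hineq => ?_⟩
  · exact ENNReal.mul_lt_top hB (ENNReal.mul_lt_top (ENNReal.rpow_lt_top_of_nonneg hp.le hD)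
      (ENNReal.inv_lt_top.2 hR0))
  set G : X → ℝ≥0∞ := (closedBall x R).piecewise g fun _ => ∞
  have hG : Measurable G := hg.piecewise measurableSet_closedBall measurable_const
  have hUG : IsUpperGradient univ (fun y => (w y : EReal)) G := by
    refine ⟨hG, fun γ _ => ?_⟩
    by_cases htop : γ.lineIntegral G = ∞
    · rw [UpperGradientIneq, htop]; exact le_top
    have hin := γ.inSet_closedBall_of_lineIntegral_ne_top hG
      (fun y hy => piecewise_eq_of_notMem _ _ _ hy) htop
    rw [UpperGradientIneq, ← EReal.coe_sub, EReal.abs_def,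
      hin.lineIntegral_congr fun y hy => (piecewise_eq_of_mem _ _ _ hy : G y = g y)]
    exact hineq γ hin
  have h := ENNReal.rpow_le_rpow (hPI x (R / L) hr w hw G hUG) hp.le
  rw [hLr, ENNReal.mul_rpow_of_nonneg _ _ hp.le, ← ENNReal.rpow_mul, ← ENNReal.rpow_mul,
    one_div_mul_cancel hp.ne', ENNReal.rpow_one, ENNReal.rpow_one, setLAverage_eq, setLAverage_eq,
    ENNReal.div_le_iff hB0.ne' hB.ne] at h
  refine h.trans ?_
  rw [mul_comm, mul_assoc, mul_assoc, ENNReal.div_eq_inv_mul]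
  refine mul_le_mul_right (mul_le_mul_right (mul_le_mul_right ?_ _) _) _
  calc ∫⁻ y in ball x R, G y ^ p ∂μ = ∫⁻ y in ball x R, g y ^ p ∂μ := by
        refine setLIntegral_congr_fun measurableSet_ball fun y hy => ?_
        simp only [G, piecewise_eq_of_mem _ _ _ (ball_subset_closedBall hy)]
    _ ≤ _ := lintegral_mono_set ball_subset_closedBall

theorem ae_eq_of_lintegral_enorm_sub_rpow_eq_zero {α : Type*} [MeasurableSpace α] {μ : Measure α}
    (hp : 0 < p) {w : α → ℝ} (hw : AEMeasurable w μ)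
    {B : Set α} {c : ℝ} (h : ∫⁻ y in B, ‖w y - c‖ₑ ^ p ∂μ = 0) :
    ∀ᵐ y ∂μ.restrict B, w y = c := by
  rw [lintegral_eq_zero_iff' (((hw.restrict.sub_const c).enorm).pow_const p)] at h
  filter_upwards [h] with y hy
  have : ‖w y - c‖ₑ = 0 := by simpa [ENNReal.rpow_eq_zero_iff, hp, hp.not_gt] using hy
  simpa [sub_eq_zero] using this

/-- A space with at least two points that supports a Poincaré inequality has no isolated points. -/
theorem SupportsPoincare.exists_ne_mem_ball (hp : 0 < p)
    (hμ : ∀ (x : X) (r : ℝ), 0 < r → 0 < μ (ball x r) ∧ μ (ball x r) < ∞)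
    (hPI : SupportsPoincare μ p p) [Nontrivial X] (x : X) {r : ℝ} (hr : 0 < r) :
    ∃ y ∈ ball x r, y ≠ x := by
  by_contra! hcon
  have hball : ball x r = {x} := subset_antisymm hcon (by simpa using hr)
  obtain ⟨y, hyx⟩ := exists_ne x
  have hd : 0 < dist y x := dist_pos.2 hyx
  obtain ⟨C, -, L, -, hPI⟩ := hPI
  -- As `{x}` is clopen, `w` is constant along curves and has upper gradient zero. The Poincaré
  -- inequality on a ball containing `x` and `y` makes `w` a.e. constant there, although both `x`
  -- and a neighbourhood of `y` have positive measure.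
  set w : X → ℝ := ({x} : Set X).indicator fun _ => 1
  have hw : Integrable w μ :=
    (integrable_indicator_iff (measurableSet_singleton x)).2
      (integrableOn_const (hball ▸ (hμ x r hr).2.ne))
  have hUG : IsUpperGradient univ (fun z => (w z : EReal)) fun _ => 0 := by
    refine ⟨measurable_const, fun γ _ => ?_⟩
    have hcont : ContinuousOn w univ := by
      refine ((IsClopen.continuous_indicator ⟨isClosed_singleton, ?_⟩
        continuous_const)).continuousOn
      rw [← hball]; exact isOpen_ball
    have hconst : w (γ.toFun 0) = w (γ.toFun γ.length) := by
      have hpre : IsPreconnected (γ.toFun '' Icc 0 γ.length) :=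
        isPreconnected_Icc.image _ γ.continuousOn
      have h0 : γ.toFun 0 ∈ γ.toFun '' Icc 0 γ.length :=
        mem_image_of_mem _ ⟨le_rfl, γ.length_pos.le⟩
      have h1 : γ.toFun γ.length ∈ γ.toFun '' Icc 0 γ.length :=
        mem_image_of_mem _ ⟨γ.length_pos.le, le_rfl⟩
      have hclopen : IsClopen ({x} : Set X) := ⟨isClosed_singleton, hball ▸ isOpen_ball⟩
      by_cases hx : γ.toFun 0 = x
      · have := hpre.subset_isClopen hclopen ⟨_, h0, hx⟩ h1
        rw [hx, this]
      · have : γ.toFun γ.length ≠ x := fun hc =>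
          hx (hpre.subset_isClopen hclopen ⟨_, h1, hc⟩ h0)
        simp [w, hx, this]
    simp [UpperGradientIneq, hconst]
  have h := hPI x (dist y x + 1) (by linarith) w hw _ hUG
  rw [ENNReal.zero_rpow_of_pos hp] at h
  simp only [laverage_zero, ENNReal.zero_rpow_of_pos (one_div_pos.2 hp), mul_zero,
    nonpos_iff_eq_zero, ENNReal.rpow_eq_zero_iff, one_div_pos.2 hp, and_true,
    (one_div_pos.2 hp).not_gt, and_false, or_false] at h
  obtain ⟨hB0, hB⟩ := hμ x (dist y x + 1) (by linarith)
  rw [setLAverage_eq, ENNReal.div_eq_zero_iff, or_iff_left hB.ne] at h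
  have hae := ae_eq_of_lintegral_enorm_sub_rpow_eq_zero hp hw.aemeasurable h
  obtain ⟨a, ha, hac⟩ := exists_mem_of_ae_restrict (A := ball x (min r 1)) measurableSet_ball
    (ball_subset_ball ((min_le_right _ _).trans (by linarith)))
    (hμ x _ (lt_min hr one_pos)).1.ne' hae
  obtain ⟨b, hb, hbc⟩ := exists_mem_of_ae_restrict (A := ball y (min (dist y x) 1))
    measurableSet_ball (fun z hz => by
      have h1 := dist_triangle z y x
      have h2 : dist z y < 1 := (mem_ball.1 hz).trans_le (min_le_right _ _)
      rw [mem_ball]; linarith)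
    (hμ y _ (lt_min hd one_pos)).1.ne' hae
  have ha' : a = x := hcon a (ball_subset_ball (min_le_left _ _) ha)
  have hb' : b ≠ x := by
    rintro rfl
    have := (mem_ball.1 hb).trans_le (min_le_left _ _)
    rw [dist_comm] at this
    exact lt_irrefl _ this
  rw [← hbc] at hac
  simp [w, ha', hb'] at hac

/-- Dirichlet functions on an open subset of a Poincaré space are locally `p`-integrable. -/
theorem MemDirichlet.exists_ball_lintegral_lt_top [Nontrivial X] (hp : 1 ≤ p)
    (hμ : ∀ (x : X) (r : ℝ), 0 < r → 0 < μ (ball x r) ∧ μ (ball x r) < ∞)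
    (hPI : SupportsPoincare μ p p) {E : Set X} (hE : IsOpen E) {u : X → EReal}
    (hu : MemDirichlet μ p E u) {x : X} (hx : x ∈ E) :
    ∃ r, 0 < r ∧ ∫⁻ y in E ∩ ball x r, (u y).abs ^ p ∂μ < ∞ := by
  have hp0 : 0 < p := one_pos.trans_le hp
  obtain ⟨hum, g, hg, hgfin⟩ := hu
  obtain ⟨R, hR, hRE⟩ := Metric.nhds_basis_closedBall.mem_iff.1 (hE.mem_nhds hx)
  obtain ⟨r, hr, hrR, K, hK, hKineq⟩ := hPI.exists_ball hp0 hμ x hR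
  have hBC : ball x r ⊆ closedBall x R := (ball_subset_ball hrR).trans ball_subset_closedBall
  have hBE : ball x r ⊆ E := hBC.trans hRE
  have hgC : ∫⁻ y in closedBall x R, g y ^ p ∂μ < ∞ := (lintegral_mono_set hRE).trans_lt hgfin
  have hM : K * ∫⁻ y in closedBall x R, g y ^ p ∂μ < ∞ := ENNReal.mul_lt_top hK hgC
  set M := K * ∫⁻ y in closedBall x R, g y ^ p ∂μ with hMdef
  obtain ⟨hB0, hB⟩ := hμ x r hr
  -- Otherwise let `w` be the indicator of `A ∩ {|u| = ∞}` for a smaller ball `A`. A curve with an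
  -- endpoint where `u` is infinite has `∫ g = ∞`, so `g / (n + 1)` is an upper gradient of `w` on
  -- the closed ball for every `n`. Thus `w` is a.e. constant on the ball, but it is 1 a.e. in `A`
  -- and 0 off `A`.
  have hfinite : ¬ ∀ᵐ y ∂μ.restrict (ball x r), (u y).abs = ∞ := by
    intro hinf
    obtain ⟨y, hyB, hyx⟩ := hPI.exists_ne_mem_ball hp0 hμ x hr
    have hd : 0 < dist y x := dist_pos.2 hyx
    have hdr : dist y x < r := hyB
    set A := ball x (dist y x / 2)
    have hAB : A ⊆ ball x r := ball_subset_ball (by linarith)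
    set w : X → ℝ := (A ∩ {z | (u z).abs = ∞}).indicator fun _ => 1
    have hw : Integrable w μ := by
      have h1 : Integrable (A.indicator fun _ => (1 : ℝ)) μ :=
        (integrable_indicator_iff measurableSet_ball).2
          (integrableOn_const ((hμ x _ (half_pos hd)).2.ne))
      refine h1.congr ?_
      filter_upwards [(ae_restrict_iff' measurableSet_ball).1 hinf] with z hz
      by_cases hzA : z ∈ A
      · simp [w, hzA, hz (hAB hzA)]
      · simp [w, hzA]
    have hbound : ∀ n : ℕ, ∫⁻ z in ball x r, ‖w z - ⨍ z in ball x r, w z ∂μ‖ₑ ^ p ∂μ ≤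
        (((n + 1 : ℕ) : ℝ≥0∞)⁻¹) ^ p * M := by
      intro n
      have hne : ((n + 1 : ℕ) : ℝ≥0∞)⁻¹ ≠ ∞ := by simp
      have hne0 : ((n + 1 : ℕ) : ℝ≥0∞)⁻¹ ≠ 0 := ENNReal.inv_ne_zero.2 (ENNReal.natCast_ne_top _)
      have h2 := hKineq w (fun z => ((n + 1 : ℕ) : ℝ≥0∞)⁻¹ * g z) hw (hg.1.const_mul _)
        fun γ hγ => ?_
      · simp_rw [ENNReal.mul_rpow_of_nonneg _ _ hp0.le] at h2
        rwa [lintegral_const_mul _ (hg.1.pow_const p), mul_left_comm, ← hMdef] at h2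
      · rw [ArcCurve.lineIntegral, lintegral_const_mul' _ _ hne]
        have hγu : (u (γ.toFun 0) - u (γ.toFun γ.length)).abs ≤
            ∫⁻ t in Icc 0 γ.length, g (γ.toFun t) :=
          hg.2 γ (hγ.mono hRE)
        by_cases hfin : (u (γ.toFun 0) - u (γ.toFun γ.length)).abs < ∞
        · obtain ⟨h0, h1⟩ := ereal_finite_of_abs_sub_lt_top hfin
          have hw0 : ∀ z, u z ≠ ⊤ ∧ u z ≠ ⊥ → w z = 0 := fun z hz => by
            refine indicator_of_notMem (fun hmem => ?_) _
            have h3 : (u z).abs = ∞ := hmem.2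
            rw [← EReal.coe_toReal hz.1 hz.2] at h3
            exact (EReal.abs_coe_lt_top _).ne h3
          rw [hw0 _ h0, hw0 _ h1]
          simp
        · rw [not_lt_top_iff.1 hfin, top_le_iff] at hγu
          rw [hγu, ENNReal.mul_top hne0]
          exact le_top
    have hlim : Tendsto (fun n : ℕ => (((n + 1 : ℕ) : ℝ≥0∞)⁻¹) ^ p * M) atTop (𝓝 0) := by
      have h1 : Tendsto (fun n : ℕ => (((n + 1 : ℕ) : ℝ≥0∞)⁻¹) ^ p) atTop (𝓝 (0 ^ p)) :=
        (ENNReal.continuous_rpow_const.tendsto 0).comp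
          (ENNReal.tendsto_inv_nat_nhds_zero.comp (tendsto_add_atTop_nat 1))
      rw [ENNReal.zero_rpow_of_pos hp0] at h1
      simpa using ENNReal.Tendsto.mul_const h1 (Or.inr hM.ne)
    have hae := ae_eq_of_lintegral_enorm_sub_rpow_eq_zero hp0 hw.aemeasurable
      (nonpos_iff_eq_zero.1 (ge_of_tendsto' hlim hbound))
    obtain ⟨a, haA, hac, hau⟩ := exists_mem_of_ae_restrict measurableSet_ball hAB
      (hμ x _ (half_pos hd)).1.ne' (hae.and hinf)
    obtain ⟨b, hb, hbc⟩ := exists_mem_of_ae_restrict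
      (A := ball y (min (dist y x / 2) (r - dist y x)))
      measurableSet_ball (fun z hz => by
        have h1 := dist_triangle z y x
        have h2 : dist z y < r - dist y x := (mem_ball.1 hz).trans_le (min_le_right _ _)
        rw [mem_ball]; linarith)
      (hμ y _ (lt_min (half_pos hd) (sub_pos.2 hdr))).1.ne' hae
    have hbA : b ∉ A := fun hbA => by
      have h1 : dist b x < dist y x / 2 := hbA
      have h2 : dist b y < dist y x / 2 := (mem_ball.1 hb).trans_le (min_le_left _ _)
      have h3 := dist_triangle_left y x b
      linarith
    have haw : w a = 1 := indicator_of_mem (show a ∈ A ∩ {z | (u z).abs = ∞} from ⟨haA, hau⟩) _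
    have hbw : w b = 0 := indicator_of_notMem (fun h => hbA h.1) _
    rw [← hbc, haw, hbw] at hac
    exact one_ne_zero hac
  have huB : AEMeasurable u (μ.restrict (ball x r)) :=
    hum.mono_measure (Measure.restrict_mono hBE le_rfl)
  obtain ⟨n, hn⟩ : ∃ n : ℕ, μ.restrict (ball x r) {y | (huB.mk u y).abs ≤ n} ≠ 0 := by
    by_contra! hcon
    apply hfinite
    have h1 : ∀ᵐ y ∂μ.restrict (ball x r), ∀ n : ℕ, ¬ (huB.mk u y).abs ≤ n :=
      ae_all_iff.2 fun n => by simpa [ae_iff] using hcon n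
    filter_upwards [h1, huB.ae_eq_mk] with y hy hyu
    rw [hyu]
    by_contra hne
    obtain ⟨n, hn⟩ := ENNReal.exists_nat_gt hne
    exact hy n hn.le
  set S : Set X := {y | (huB.mk u y).abs ≤ n}
  have hS : MeasurableSet S := (measurable_ereal_abs.comp huB.measurable_mk) measurableSet_Iic
  set ν := μ.restrict (ball x r)
  have hνfin : ν univ < ∞ := by simpa [ν] using hB
  have hνS : ν S < ∞ := (measure_mono (subset_univ S)).trans_lt hνfin
  -- A bound for `|c|^p`, where `c` is the mean of any truncation: on `S` one has `|c| ≤ |v k - c| +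
  -- n`, and this is raised to the power `p` and averaged over `S`. It does not depend on `k`.
  set Q : ℝ≥0∞ := (2 ^ (p - 1) * (M + (n : ℝ≥0∞) ^ p * ν S)) / ν S
  have h2p : (2 : ℝ≥0∞) ^ (p - 1) < ∞ :=
    ENNReal.rpow_lt_top_of_nonneg (by linarith) ENNReal.ofNat_ne_top
  have hnp : (n : ℝ≥0∞) ^ p < ∞ := ENNReal.rpow_lt_top_of_nonneg hp0.le (ENNReal.natCast_ne_top n)
  have hQ : Q < ∞ := ENNReal.div_lt_top (ENNReal.mul_lt_top h2p
    (ENNReal.add_lt_top.2 ⟨hM, ENNReal.mul_lt_top hnp hνS⟩)).ne hn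
  set v : ℕ → X → ℝ := fun k => (closedBall x R).indicator fun y => trunc k (u y)
  have hv : ∀ k, ∀ y ∈ closedBall x R, v k y = trunc k (u y) := fun k y hy =>
    indicator_of_mem hy _
  have hvm : ∀ k, AEMeasurable (v k) μ := fun k =>
    (aemeasurable_indicator_iff measurableSet_closedBall).2
      ((measurable_trunc k).comp_aemeasurable (hum.mono_measure (Measure.restrict_mono hRE le_rfl)))
  have hmain : ∀ k, ∫⁻ y, ‖v k y‖ₑ ^ p ∂ν ≤ 2 ^ (p - 1) * (M + Q * ν univ) := by
    intro k
    have hvi : Integrable (v k) μ := by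
      refine (integrable_indicator_iff measurableSet_closedBall).2
        ⟨(hvm k).aestronglyMeasurable.restrict.congr
          (ae_restrict_of_forall_mem measurableSet_closedBall (hv k)), ?_⟩
      refine (lintegral_mono fun y => ?_).trans_lt
        (?_ : ∫⁻ _ in closedBall x R, (k : ℝ≥0∞) ∂μ < ∞)
      · rw [enorm_trunc]; exact min_le_right _ _
      · rw [setLIntegral_const]
        refine ENNReal.mul_lt_top (ENNReal.natCast_lt_top k) ?_
        exact (measure_mono (closedBall_subset_ball (lt_add_one R))).trans_lt
          (hμ x (R + 1) (by linarith)).2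
    have hPk := hKineq (v k) g hvi hg.1 fun γ hγ => by
      rw [hv k _ (hγ 0 ⟨le_rfl, γ.length_pos.le⟩), hv k _ (hγ _ ⟨γ.length_pos.le, le_rfl⟩)]
      exact (abs_trunc_sub_trunc_le k _ _).trans (hg.2 γ (hγ.mono hRE))
    rw [← hMdef] at hPk
    set c := ⨍ z in ball x r, v k z ∂μ
    have hcm : AEMeasurable (fun y => ‖v k y - c‖ₑ ^ p) ν :=
      (((hvm k).restrict.sub_const c).enorm).pow_const p
    have hcQ : ‖c‖ₑ ^ p ≤ Q := by
      rw [ENNReal.le_div_iff_mul_le (Or.inl hn) (Or.inl hνS.ne)]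
      calc ‖c‖ₑ ^ p * ν S = ∫⁻ _ in S, ‖c‖ₑ ^ p ∂ν := (setLIntegral_const _ _).symm
        _ ≤ ∫⁻ y in S, 2 ^ (p - 1) * (‖v k y - c‖ₑ ^ p + (n : ℝ≥0∞) ^ p) ∂ν := by
          refine setLIntegral_mono_ae' hS ?_
          filter_upwards [huB.ae_eq_mk, ae_restrict_mem measurableSet_ball] with y hyu hyB hyS
          refine le_trans (ENNReal.rpow_le_rpow (?_ : ‖c‖ₑ ≤ ‖v k y - c‖ₑ + n) hp0.le)
            (ENNReal.rpow_add_le_mul_rpow_add_rpow _ _ hp)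
          have h1 : ‖v k y‖ₑ ≤ n := by
            rw [hv k y (hBC hyB), enorm_trunc, hyu]
            exact (min_le_left _ _).trans hyS
          calc ‖c‖ₑ = ‖v k y - (v k y - c)‖ₑ := by rw [sub_sub_cancel]
            _ ≤ ‖v k y‖ₑ + ‖v k y - c‖ₑ := enorm_sub_le
            _ ≤ ‖v k y - c‖ₑ + n := by rw [add_comm]; gcongr
        _ = 2 ^ (p - 1) * (∫⁻ y in S, ‖v k y - c‖ₑ ^ p ∂ν + (n : ℝ≥0∞) ^ p * ν S) := by
          rw [lintegral_const_mul' _ _ h2p.ne, lintegral_add_right' _ aemeasurable_const,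
            setLIntegral_const]
        _ ≤ _ := by
          gcongr
          exact (setLIntegral_le_lintegral _ _).trans hPk
    calc ∫⁻ y, ‖v k y‖ₑ ^ p ∂ν ≤ ∫⁻ y, 2 ^ (p - 1) * (‖v k y - c‖ₑ ^ p + Q) ∂ν := by
          refine lintegral_mono fun y => ?_
          calc ‖v k y‖ₑ ^ p = ‖(v k y - c) + c‖ₑ ^ p := by rw [sub_add_cancel]
            _ ≤ (‖v k y - c‖ₑ + ‖c‖ₑ) ^ p := ENNReal.rpow_le_rpow (enorm_add_le _ _) hp0.le
            _ ≤ 2 ^ (p - 1) * (‖v k y - c‖ₑ ^ p + ‖c‖ₑ ^ p) :=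
              ENNReal.rpow_add_le_mul_rpow_add_rpow _ _ hp
            _ ≤ _ := by gcongr
      _ = 2 ^ (p - 1) * (∫⁻ y, ‖v k y - c‖ₑ ^ p ∂ν + Q * ν univ) := by
          rw [lintegral_const_mul' _ _ h2p.ne, lintegral_add_right' _ aemeasurable_const,
            lintegral_const]
      _ ≤ _ := by gcongr
  refine ⟨r, hr, ?_⟩
  rw [inter_eq_right.2 hBE]
  have htend : ∀ᵐ y ∂ν, Tendsto (fun k => ‖v k y‖ₑ ^ p) atTop (𝓝 ((u y).abs ^ p)) := by
    filter_upwards [ae_restrict_mem measurableSet_ball] with y hy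
    refine (ENNReal.continuous_rpow_const.tendsto _).comp ?_
    simp_rw [hv _ y (hBC hy), enorm_trunc]
    simpa using (tendsto_const_nhds (x := (u y).abs)).min ENNReal.tendsto_nat_nhds_top
  -- Fatou's lemma passes the uniform bound from the truncations to `u`.
  calc ∫⁻ y, (u y).abs ^ p ∂ν = ∫⁻ y, liminf (fun k => ‖v k y‖ₑ ^ p) atTop ∂ν :=
        lintegral_congr_ae (htend.mono fun y hy => hy.liminf_eq.symm)
    _ ≤ liminf (fun k => ∫⁻ y, ‖v k y‖ₑ ^ p ∂ν) atTop := by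
        refine lintegral_liminf_le' fun k => ?_
        exact (hvm k).restrict.enorm.pow_const p
    _ ≤ 2 ^ (p - 1) * (M + Q * ν univ) := liminf_le_of_frequently_le' (.of_forall hmain)
    _ < ∞ := ENNReal.mul_lt_top h2p (ENNReal.add_lt_top.2 ⟨hM, ENNReal.mul_lt_top hQ hνfin⟩)

end Poincare

/-! ### Admissible perturbations and the superminimizer property -/

section Superminimizers

variable {X : Type*} [MetricSpace X] [MeasurableSpace X] [BorelSpace X] {μ : Measure X} {p : ℝ}

/-- Dirichlet functions on an open subset of a Poincaré space are locally Newtonian. -/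
theorem MemDirichlet.memNewtonianLoc [SecondCountableTopology X] [Nontrivial X] (hp : 1 ≤ p)
    (hμ : ∀ (x : X) (r : ℝ), 0 < r → 0 < μ (ball x r) ∧ μ (ball x r) < ∞)
    (hPI : SupportsPoincare μ p p) {E : Set X} (hE : IsOpen E) {u : X → EReal}
    (hu : MemDirichlet μ p E u) : MemNewtonianLoc μ p E u := by
  intro x hx
  obtain ⟨r, hr, hfin⟩ := hu.exists_ball_lintegral_lt_top hp hμ hPI hE hx
  have hD : MemDirichlet μ p (E ∩ ball x r) u := hu.mono inter_subset_left
  refine ⟨x, hx, r, mem_ball_self hr, fun y hy => ⟨y, hy, 1, mem_ball_self one_pos,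
    hD.mono inter_subset_left⟩, ?_⟩
  exact ENNReal.add_lt_top.2
    ⟨hfin, (hD.minGrad_spec (one_pos.trans_le hp) (hE.inter isOpen_ball)).2⟩

/-- Adding a nonnegative function with zero boundary values preserves admissibility. -/
theorem Admissible.add [SecondCountableTopology X] (hp : 1 ≤ p) {V : Set X} (hV : IsOpen V)
    {ψ f u φ : X → EReal} (hu : Admissible μ p V ψ f u) (hφ : MemDirichletZero μ p V φ)
    (hφ0 : ∀ x ∈ V, 0 ≤ φ x) : Admissible μ p V ψ f (fun x => u x + φ x) := by
  obtain ⟨huD, ⟨w, hw, hw0, hwu⟩, hcap⟩ := hu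
  obtain ⟨z, hz, hz0, hzφ⟩ := hφ
  refine ⟨huD.add hp ((hz.mono (subset_univ V)).congr hV.measurableSet hzφ),
    ⟨fun x => w x + z x, hw.add hp hz, fun x hx => by simp [hw0 x hx, hz0 x hx], fun x hx => ?_⟩,
    nonpos_iff_eq_zero.1 (hcap ▸ capacity_mono ?_)⟩
  · simp only [hwu x hx, hzφ x hx]
    -- Addition on `EReal` is commutative and associative, so the rearrangement holds at infinite
    -- values too.
    rw [sub_eq_add_neg, sub_eq_add_neg, add_right_comm]
  · rintro x ⟨hx, hxψ⟩
    exact ⟨hx, fun hle => hxψ (hle.trans (le_add_of_nonneg_right (hφ0 x hx)))⟩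

end Superminimizers

end ObstacleProblem

theorem proposition3p9 {X : Type*} [MetricSpace X] [ProperSpace X] [MeasurableSpace X]
    [BorelSpace X] (μ : MeasureTheory.Measure X)
    (hμ : ∀ (x : X) (r : ℝ), 0 < r → 0 < μ (Metric.ball x r) ∧ μ (Metric.ball x r) < ⊤)
    (p : ℝ) (hp : 1 < p) (hPI : ObstacleProblem.SupportsPoincare μ p p)
    (Ω : Set X) (hΩ : IsOpen Ω) (hΩne : Ω.Nonempty)
    (hcap : 0 < ObstacleProblem.capacity μ p Ωᶜ)
    (ψ f : X → EReal) (hf : ObstacleProblem.MemDirichlet μ p Ω f)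
    (u : X → EReal) (hu : ObstacleProblem.IsObstacleSolution μ p Ω ψ f u) :
    ObstacleProblem.IsSuperminimizer μ p Ω u := by
  open ObstacleProblem in
  have hp0 : 0 < p := one_pos.trans hp
  obtain ⟨x₀, hx₀⟩ := hΩne
  obtain ⟨y₀, hy₀⟩ : Ωᶜ.Nonempty := by
    rw [nonempty_iff_ne_empty]
    intro he
    rw [he, capacity_empty hp0] at hcap
    exact hcap.false
  have : Nontrivial X := ⟨x₀, y₀, fun h => hy₀ (h ▸ hx₀)⟩
  have hμ0 : μ univ ≠ 0 :=
    ((hμ x₀ 1 one_pos).1.trans_le (measure_mono (subset_univ _))).ne'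
  obtain ⟨huA, humin⟩ := hu
  refine ⟨huA.1.memNewtonianLoc hp.le hμ hPI hΩ, fun φ hφ hφ0 => ?_⟩
  obtain ⟨z, hz, hz0, hzφ⟩ := hφ
  have hzD := hz.memDirichlet hp0 hμ0
  have hvA := huA.add hp.le hΩ ⟨z, hzD, hz0, hzφ⟩ hφ0
  have hle := humin _ hvA
  have hzm : AEMeasurable z μ := by simpa using hzD.1
  -- A measurable stand-in for `{φ = 0}`, needed because `φ` is only a.e. measurable.
  set S : Set X := {x | hzm.mk z x = 0}
  have hS : MeasurableSet S := hzm.measurable_mk (measurableSet_singleton 0)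
  have hae : ∀ᵐ x ∂μ.restrict Ω, φ x = hzm.mk z x := by
    filter_upwards [ae_restrict_of_ae hzm.ae_eq_mk, ae_restrict_mem hΩ.measurableSet] with x h1 h2
    rw [← hzφ x h2, h1]
  have hset : ({x ∈ Ω | φ x ≠ 0} : Set X) =ᵐ[μ] (Ω \ S : Set X) := by
    rw [ae_restrict_iff' hΩ.measurableSet] at hae
    refine Filter.eventuallyEq_set.2 (hae.mono fun x hx => ?_)
    exact and_congr_right fun hxΩ => not_congr (by rw [hx hxΩ]; rfl)
  have hloc : ∫⁻ x in Ω ∩ S, minGrad μ p Ω (fun y => u y + φ y) x ^ p ∂μ ≤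
      ∫⁻ x in Ω ∩ S, minGrad μ p Ω u x ^ p ∂μ := by
    have h := minGrad_ae_le_of_eq hp0 hΩ hvA.1 huA.1 hS (hae.mono fun x hx hxS => by
      have : φ x = 0 := hx.trans hxS
      rw [this, add_zero])
    rw [ae_restrict_iff' hΩ.measurableSet] at h
    refine lintegral_mono_ae ((ae_restrict_iff' (hΩ.measurableSet.inter hS)).2 ?_)
    filter_upwards [h] with x hx hxΩ using ENNReal.rpow_le_rpow (hx hxΩ.1 hxΩ.2) hp0.le
  have hfin : ∫⁻ x in Ω ∩ S, minGrad μ p Ω u x ^ p ∂μ ≠ ⊤ :=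
    ((lintegral_mono_set inter_subset_left).trans_lt (huA.1.minGrad_spec hp0 hΩ).2).ne
  rw [setLIntegral_congr hset, setLIntegral_congr hset]
  -- Split both energies along `S`. By `hloc` the part of `u + φ` on `S` is at most that of `u`,
  -- which is finite and cancels.
  rw [← lintegral_inter_add_sdiff _ Ω hS, ← lintegral_inter_add_sdiff _ Ω hS] at hle
  exact (ENNReal.add_le_add_iff_left hfin).1 (hle.trans (add_le_add_left hloc _))
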